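/- Let $\lambda>0$, $\nu:=\sqrt{\tfrac14+\lambda}$, $T\in(0,\infty]$, $\dot{\mathbb R}:=\mathbb R\setminus\{0\}$, and $$G(t,x,y)=\frac{\Theta(xy)\sqrt{xy}}{2\,i^{\nu+1}t}\;e^{-\frac{x^2+y^2}{4it}}\;J_\nu\!\Big(\frac{xy}{2t}\Big),\qquad t\in(0,T),\ x,y\in\dot{\mathbb R},$$ where $\Theta$ is the step function, $J_\nu$ is the Bessel function of the first kind, and $i^{\nu+1}=e^{i\pi(\nu+1)/2}$. Then $G$ satisfies the following conditions, which define a Green's function of the Schrödinger equation on $\dot{\mathbb R}$ with the repulsive centrifugal potential $V(t,x)=\lambda/x^2$ and the transmission matrices $M=I$, $N=0$ (Dirichlet conditions at $0^\pm$). Notation: for an open interval $I$, $\operatorname{AC}(I)$ is the set of $f$ for which there is $g\in L^1_{\rm loc}(I)$ with $f(y)-f(x)=\int_x^y g(s)\,ds$ for all $x,y\in I$; $f\in\operatorname{AC}(\dot{\mathbb R})$ means that the restrictions of $f$ to $(-\infty,0)$ and to $(0,\infty)$ are in $\operatorname{AC}$; $\operatorname{AC}_{1,2}((0,T)\times\dot{\mathbb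 R})$ is the set of $\Psi:(0,T)\times\dot{\mathbb R}\to\mathbb C$ with $\Psi(\cdot,x)\in\operatorname{AC}((0,T))$ for all $x\in\dot{\mathbb R}$, and with $\Psi(t,\cdot)$ differentiable on $\dot{\mathbb R}$ and $\Psi(t,\cdot),\Psi_x(t,\cdot)\in\operatorname{AC}(\dot{\mathbb R})$ for all $t\in(0,T)$. There are an angle $\alpha\in(0,\frac\pi2)$ and a continuation of $G$ to a function $G:(0,T)\times\dot{\mathbb R}\times S_\alpha\to\mathbb C$ on the double sector $S_\alpha=\{z\in\mathbb C\setminus\{0\}:\operatorname{Arg}z\in[0,\alpha]\cup[\pi,\pi+\alpha]\}$ such that for all $t\in(0,T)$, $x\in\dot{\mathbb R}$ the map $G(t,x,\cdot)$ is continuous on $S_\alpha$ and holomorphic on $\operatorname{int}S_\alpha$, and: (i) For every $z\in S_\alpha$, $G(\cdot,\cdot,z)\in\operatorname{AC}_{1,2}((0,T)\times\dot{\mathbb R})$ and $$i\,\partial_tG(t,x,z)=\Big(-\partial_x^2+\frac{\lambda}{x^2}\Big)G(t,x,z)\quad\text{for a.e. }(t,x)\in(0,T)\times\dot{\mathbb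 R}.$$ For every $y\in\dot{\mathbb R}$ and $t\in(0,T)$ the one-sided limits of $G(t,x,y)$ and $G_x(t,x,y)$ as $x\to0^\pm$ exist and $$M\begin{pmatrix}G(t,0^+,y)\\G(t,0^-,y)\end{pmatrix}=N\begin{pmatrix}G_x(t,0^+,y)\\-G_x(t,0^-,y)\end{pmatrix}\quad\text{with } M=I,\ N=0,$$ that is, $G(t,0^\pm,y)=0$. (ii) For every $x\in\dot{\mathbb R}$ there is $x_0>|x|$ such that $$\lim_{t\to0^+}\int_{-x_0}^{x_0}G(t,x,y)\varphi(y)\,dy=\varphi(x)\quad\text{for all complex-valued }\varphi\in C^\infty([-x_0,x_0]).$$ (iii) There are $a\in\operatorname{AC}((0,T))$ with $a(t)>0$ and $\lim_{t\to0^+}a(t)=\infty$, an exponent $p\in(0,2)$, and continuous functions $A_j,B_j:(0,T)\times\dot{\mathbb R}\to[0,\infty)$, $j=0,1,2$, such that the function $\widetilde G$ defined by $G(t,x,z)=e^{ia(t)(z-x)^2}\widetilde G(t,x,z)$ has the derivatives below at every $t\in(0,T)$, $x\in\dot{\mathbb R}$, $z\in S_\alpha$, and satisfies there $$|\widetilde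 G|\le A_0(t,x)e^{B_0(t,x)|z|^p},\qquad|\partial_x\widetilde G|\le A_1(t,x)e^{B_1(t,x)|z|^p},\qquad|\partial_x^2\widetilde G|,\,|\partial_t\widetilde G|\le A_2(t,x)e^{B_2(t,x)|z|^p}.$$ Moreover, for every $x\in\dot{\mathbb R}$, $A_0(t,x)/\sqrt{a(t)}$ and $B_0(t,x)$ are bounded as $t\to0^+$; and for every $t\in(0,T)$, $A_0(t,\cdot)$ and $B_0(t,\cdot)$ are bounded as $x\to0^\pm$. -/

import Mathlib

open Filter Topology MeasureTheory
open scoped ContDiff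

noncomputable section

namespace SchrodingerGreen

/-- The double sector `{z ≠ 0 | Arg z ∈ [0, α] ∪ [π, π + α]}`. As `Complex.arg` takes values
in `(-π, π]`, the second range of arguments of `z` is written as `Arg (-z) ∈ [0, α]`. -/
def doubleSector (α : ℝ) : Set ℂ :=
  {z | z ≠ 0 ∧ (Complex.arg z ∈ Set.Icc 0 α ∨ Complex.arg (-z) ∈ Set.Icc 0 α)}

/-- The time interval `(0, T)` for `T ∈ (0, ∞]`. -/
def timeInterval (T : EReal) : Set ℝ :=
  {t | 0 < t ∧ (t : EReal) < T}

/-- The space `AC(I)` for an open interval `I`: functions that are integrals of an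
`L¹_loc(I)` function. -/
def ACOn {E : Type*} [NormedAddCommGroup E] [NormedSpace ℝ E] (f : ℝ → E) (I : Set ℝ) : Prop :=
  ∃ g : ℝ → E, LocallyIntegrableOn g I volume ∧
    ∀ x ∈ I, ∀ y ∈ I, f y - f x = ∫ s in x..y, g s

/-- The space `AC(ℝ ∖ {0})`. -/
def ACDot (f : ℝ → ℂ) : Prop :=
  ACOn f (Set.Iio 0) ∧ ACOn f (Set.Ioi 0)

/-- The space `AC_{1,2}((0,T) × (ℝ ∖ {0}))`. -/
structure AC12 (T : EReal) (Ψ : ℝ → ℝ → ℂ) : Prop where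
  time : ∀ x : ℝ, x ≠ 0 → ACOn (fun t => Ψ t x) (timeInterval T)
  space : ∀ t ∈ timeInterval T, ACDot (Ψ t)
  differentiable : ∀ t ∈ timeInterval T, ∀ x : ℝ, x ≠ 0 → DifferentiableAt ℝ (Ψ t) x
  space_deriv : ∀ t ∈ timeInterval T, ACDot (deriv (Ψ t))

/-- `Ψ` solves `i ∂ₜΨ = (-∂ₓ² + V)Ψ` for almost every `(t, x) ∈ (0,T) × (ℝ ∖ {0})`. -/
def SolvesSchrodinger (T : EReal) (V Ψ : ℝ → ℝ → ℂ) : Prop :=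
  ∀ᵐ q : ℝ × ℝ, q.1 ∈ timeInterval T → q.2 ≠ 0 →
    ∃ dt dxx : ℂ, HasDerivAt (fun s => Ψ s q.2) dt q.1 ∧ HasDerivAt (deriv (Ψ q.1)) dxx q.2 ∧
      Complex.I * dt = -dxx + V q.1 q.2 * Ψ q.1 q.2

/-- The one-sided limits of `f` and `f'` at `0` exist and
`M (f(0⁺), f(0⁻))ᵀ = N (f'(0⁺), -f'(0⁻))ᵀ`. -/
def TransmissionCondition (M N : Matrix (Fin 2) (Fin 2) ℂ) (f : ℝ → ℂ) : Prop :=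
  ∃ fp fm dp dm : ℂ,
    Tendsto f (𝓝[>] 0) (𝓝 fp) ∧ Tendsto f (𝓝[<] 0) (𝓝 fm) ∧
    Tendsto (deriv f) (𝓝[>] 0) (𝓝 dp) ∧ Tendsto (deriv f) (𝓝[<] 0) (𝓝 dm) ∧
    M.mulVec ![fp, fm] = N.mulVec ![dp, -dm]

/-- `f` is bounded near the limit point described by the filter `l`. -/
def BoundedAs (l : Filter ℝ) (f : ℝ → ℝ) : Prop :=
  ∃ C : ℝ, ∀ᶠ s in l, |f s| ≤ C

/-- A continuous coefficient `(0,T) × (ℝ ∖ {0}) → [0,∞)`. -/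
def IsCoefficient (T : EReal) (A : ℝ → ℝ → ℝ) : Prop :=
  ContinuousOn (fun q : ℝ × ℝ => A q.1 q.2) (timeInterval T ×ˢ {0}ᶜ) ∧
    ∀ t ∈ timeInterval T, ∀ x : ℝ, x ≠ 0 → 0 ≤ A t x

/-- The factor `Gt` in `G(t,x,z) = e^{i a(t) (z-x)²} Gt(t,x,z)` and its derivatives are
exponentially bounded on `S`, with growth order `p` and coefficients `A`, `B`
(indexed by `0, 1, 2`). -/
structure ExponentialBounds (T : EReal) (M N : Matrix (Fin 2) (Fin 2) ℂ) (S : Set ℂ)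
    (G Gt : ℝ → ℝ → ℂ → ℂ) (a : ℝ → ℝ) (p : ℝ) (A B : Fin 3 → ℝ → ℝ → ℝ) : Prop where
  ac : ACOn a (timeInterval T)
  pos : ∀ t ∈ timeInterval T, 0 < a t
  tendsto : Tendsto a (𝓝[>] 0) atTop
  decomposition : ∀ t ∈ timeInterval T, ∀ x : ℝ, x ≠ 0 → ∀ z ∈ S,
    G t x z = Complex.exp (Complex.I * a t * (z - x) ^ 2) * Gt t x z
  p_mem : p ∈ Set.Ioo (0 : ℝ) 2
  coeffA : ∀ j, IsCoefficient T (A j)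
  coeffB : ∀ j, IsCoefficient T (B j)
  bound : ∀ t ∈ timeInterval T, ∀ x : ℝ, x ≠ 0 → ∀ z ∈ S,
    ‖Gt t x z‖ ≤ A 0 t x * Real.exp (B 0 t x * ‖z‖ ^ p)
  bound_x : ∀ t ∈ timeInterval T, ∀ x : ℝ, x ≠ 0 → ∀ z ∈ S,
    ∃ d : ℂ, HasDerivAt (fun x' => Gt t x' z) d x ∧
      ‖d‖ ≤ A 1 t x * Real.exp (B 1 t x * ‖z‖ ^ p)
  bound_xx : ∀ t ∈ timeInterval T, ∀ x : ℝ, x ≠ 0 → ∀ z ∈ S,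
    ∃ d : ℂ, HasDerivAt (deriv fun x' => Gt t x' z) d x ∧
      ‖d‖ ≤ A 2 t x * Real.exp (B 2 t x * ‖z‖ ^ p)
  bound_t : ∀ t ∈ timeInterval T, ∀ x : ℝ, x ≠ 0 → ∀ z ∈ S,
    ∃ d : ℂ, HasDerivAt (fun t' => Gt t' x z) d t ∧
      ‖d‖ ≤ A 2 t x * Real.exp (B 2 t x * ‖z‖ ^ p)
  bounded_time : ∀ x : ℝ, x ≠ 0 →
    BoundedAs (𝓝[>] 0) (fun t => A 0 t x / √(a t)) ∧ BoundedAs (𝓝[>] 0) (fun t => B 0 t x)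
  bounded_space : M ≠ 0 → N = 0 → ∀ t ∈ timeInterval T,
    BoundedAs (𝓝[≠] 0) (A 0 t) ∧ BoundedAs (𝓝[≠] 0) (B 0 t)
  bounded_space_deriv : N ≠ 0 → ∀ t ∈ timeInterval T,
    BoundedAs (𝓝[≠] 0) (A 0 t) ∧ BoundedAs (𝓝[≠] 0) (A 1 t) ∧
    BoundedAs (𝓝[≠] 0) (B 0 t) ∧ BoundedAs (𝓝[≠] 0) (B 1 t)

/-- `Gc` is a continuation of `G` to the double sector of angle `α` with all the properties
required of a Green's function for the potential `V` and the transmission matrices `M`, `N`. -/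
structure IsGreenContinuation (T : EReal) (V : ℝ → ℝ → ℂ) (M N : Matrix (Fin 2) (Fin 2) ℂ)
    (G : ℝ → ℝ → ℝ → ℂ) (α : ℝ) (Gc : ℝ → ℝ → ℂ → ℂ) : Prop where
  extends_G : ∀ t ∈ timeInterval T, ∀ x : ℝ, x ≠ 0 → ∀ y : ℝ, y ≠ 0 → Gc t x y = G t x y
  continuousOn : ∀ t ∈ timeInterval T, ∀ x : ℝ, x ≠ 0 →
    ContinuousOn (Gc t x) (doubleSector α)
  holomorphic : ∀ t ∈ timeInterval T, ∀ x : ℝ, x ≠ 0 →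
    DifferentiableOn ℂ (Gc t x) (interior (doubleSector α))
  ac12 : ∀ z ∈ doubleSector α, AC12 T (fun t x => Gc t x z)
  schrodinger : ∀ z ∈ doubleSector α, SolvesSchrodinger T V (fun t x => Gc t x z)
  transmission : ∀ y : ℝ, y ≠ 0 → ∀ t ∈ timeInterval T,
    TransmissionCondition M N (fun x => G t x y)
  initial : ∀ x : ℝ, x ≠ 0 → ∃ x₀ : ℝ, |x| < x₀ ∧
    ∀ φ : ℝ → ℂ, ContDiffOn ℝ ∞ φ (Set.Icc (-x₀) x₀) →
      Tendsto (fun t => ∫ y in (-x₀)..x₀, G t x y * φ y) (𝓝[>] 0) (𝓝 (φ x))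
  bounds : ∃ (a : ℝ → ℝ) (Gt : ℝ → ℝ → ℂ → ℂ) (p : ℝ) (A B : Fin 3 → ℝ → ℝ → ℝ),
    ExponentialBounds T M N (doubleSector α) Gc Gt a p A B

/-- The conditions on a Green's function `G : (0,T) × (ℝ ∖ {0}) × (ℝ ∖ {0}) → ℂ` of the
Schrödinger equation with potential `V` and transmission matrices `M`, `N`. Only the values of
`G` and `V` on these domains matter. -/
def GreenAssumption (T : EReal) (V : ℝ → ℝ → ℂ) (M N : Matrix (Fin 2) (Fin 2) ℂ)
    (G : ℝ → ℝ → ℝ → ℂ) : Prop :=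
  ∃ α ∈ Set.Ioo 0 (Real.pi / 2), ∃ Gc : ℝ → ℝ → ℂ → ℂ, IsGreenContinuation T V M N G α Gc

/-- The Bessel function of the first kind
`J_ν(w) = (w/2)^ν ∑ₖ (-1)ᵏ / (k! Γ(ν+k+1)) (w/2)^{2k}`, with the principal branch of the power. -/
def besselJ (ν w : ℂ) : ℂ :=
  (w / 2) ^ ν *
    ∑' k : ℕ, (-1) ^ k / ((k.factorial : ℂ) * Complex.Gamma (ν + k + 1)) * (w / 2) ^ (2 * k)

/-- The step function `Θ`. -/
def heaviside (s : ℝ) : ℝ :=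
  if 0 < s then 1 else 0

/-- The kernel `Θ(xy) √(xy) / (2 i^{ν+1} t) · e^{-(x²+y²)/(4it)} · J_ν(xy/(2t))`. -/
def besselKernel (ν t x y : ℝ) : ℂ :=
  (heaviside (x * y) * √(x * y) : ℝ) / (2 * Complex.I ^ ((ν : ℂ) + 1) * t) *
    Complex.exp (-((x : ℂ) ^ 2 + (y : ℂ) ^ 2) / (4 * Complex.I * t)) *
    besselJ ν (x * y / (2 * t))

end SchrodingerGreen

end

/-!
Put `H(w) = e^{iw} √w J_ν(w)`. The kernel is `e^{i(z-x)²/(4t)}` times a multiple of `H(xz/(2t))`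
where `Re (xz) > 0`, and zero elsewhere, so everything rests on the behaviour of `H` in the closed
first quadrant. Bessel's equation becomes `H'' = 2i H' + (ν² - 1/4) w⁻² H`. Along a ray in the
quadrant the term `2i H'` only dissipates the energy `|H'|² + |2i H - H'|²`, which is therefore
bounded by Grönwall's inequality; this bounds `H` and `H'`, hence the non-Gaussian factor of the
kernel and its derivatives.

Since `(2i H - H')' = O(|w|⁻²)`, the function `2i H - H'` has the same limit at infinity along both
axes, and Poisson's integral for `J_ν` identifies it on the imaginary axis. Together with
`H'(r) = c e^{2ir} + O(1/r)` this gives `H(r) = i^{ν+1/2} / √(2π) + D e^{2ir} + O(1/r)` on the real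
axis. In the initial condition for `x > 0` the constant term produces a Fresnel kernel centred at
`y = x`, which reproduces `φ(x)`; the factor `e^{2ir}` moves the centre to `-x`, outside the domain
of integration `y > 0`; the remainder is absolutely small.
-/

noncomputable section

namespace SchrodingerGreen

open Complex
open scoped Real

/-- The Fourier–Laplace transform of the density `k` on `[-1, 1]`. -/
def fourierLaplace (k : ℝ → ℂ) (w : ℂ) : ℂ :=
  ∫ s in (-1 : ℝ)..1, k s * exp (I * w * s)

lemma abs_le_one_of_mem_uIoc {s : ℝ} (hs : s ∈ Set.uIoc (-1 : ℝ) 1) : |s| ≤ 1 := by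
  rw [Set.uIoc_of_le (by norm_num)] at hs
  exact abs_le.2 ⟨hs.1.le, hs.2⟩

lemma norm_exp_I_mul_mul_le (w : ℂ) {s : ℝ} (hs : |s| ≤ 1) :
    ‖exp (I * w * s)‖ ≤ Real.exp ‖w‖ := by
  refine (norm_exp_le_exp_norm _).trans (Real.exp_le_exp.2 ?_)
  simpa using mul_le_of_le_one_right (norm_nonneg w) hs

lemma hasDerivAt_fourierLaplace {k : ℝ → ℂ} (hk : Continuous k) (w : ℂ) :
    HasDerivAt (fourierLaplace k) (fourierLaplace (fun s => k s * (I * s)) w) w := by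
  refine (intervalIntegral.hasDerivAt_integral_of_dominated_loc_of_deriv_le
    (F' := fun w s => k s * (I * s) * exp (I * w * s))
    (bound := fun s => ‖k s‖ * Real.exp (‖w‖ + 1)) (Metric.ball_mem_nhds w one_pos)
    (.of_forall fun _ => Continuous.aestronglyMeasurable (by fun_prop))
    (Continuous.intervalIntegrable (by fun_prop) _ _)
    (Continuous.aestronglyMeasurable (by fun_prop))
    (.of_forall fun s hs w' hw' => ?_)
    (Continuous.intervalIntegrable (by fun_prop) _ _)
    (.of_forall fun s _ w' _ => ?_)).2
  · have hs := abs_le_one_of_mem_uIoc hs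
    have hw' : ‖w'‖ ≤ ‖w‖ + 1 := by
      linarith [norm_sub_norm_le w' w, mem_ball_iff_norm.1 hw']
    calc ‖k s * (I * s) * exp (I * w' * s)‖ = ‖k s‖ * |s| * ‖exp (I * w' * s)‖ := by simp
      _ ≤ ‖k s‖ * 1 * Real.exp (‖w‖ + 1) := by
        gcongr
        exact (norm_exp_I_mul_mul_le w' hs).trans (Real.exp_le_exp.2 hw')
      _ = ‖k s‖ * Real.exp (‖w‖ + 1) := by rw [mul_one]
  · have h : HasDerivAt (fun w : ℂ => I * w * s) (I * s) w' := by
      simpa using ((hasDerivAt_id w').const_mul I).mul_const (s : ℂ)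
    exact (h.cexp.const_mul (k s)).congr_deriv (by ring)

/-- The weight `(1 - s²)^{ν - 1/2}` in Poisson's integral representation of `J_ν`. -/
def poissonWeight (ν s : ℝ) : ℝ := (1 - s ^ 2) ^ (ν - 1 / 2)

/-- The constant `√π Γ(ν + 1/2)` in Poisson's integral representation of `J_ν`. -/
def poissonConst (ν : ℝ) : ℝ := √π * Real.Gamma (ν + 1 / 2)

/-- The entire function `J_ν(w) / (w/2)^ν`. -/
def besselEntire (ν : ℝ) (w : ℂ) : ℂ :=
  ∑' k : ℕ, (-1) ^ k / ((k.factorial : ℂ) * Gamma ((ν : ℂ) + k + 1)) * (w / 2) ^ (2 * k)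

section PoissonRepresentation

variable {ν : ℝ}

lemma poissonConst_pos (hν : -1 / 2 < ν) : 0 < poissonConst ν :=
  mul_pos (Real.sqrt_pos.2 Real.pi_pos) (Real.Gamma_pos_of_pos (by linarith))

@[fun_prop]
lemma continuous_poissonWeight (hν : 1 / 2 ≤ ν) : Continuous (poissonWeight ν) :=
  Continuous.rpow_const (by fun_prop) fun _ => Or.inr (by linarith)

lemma poissonWeight_neg (ν s : ℝ) : poissonWeight ν (-s) = poissonWeight ν s := by
  simp [poissonWeight]

lemma poissonWeight_eq_zero (hν : 1 / 2 < ν) {s : ℝ} (hs : s ^ 2 = 1) : poissonWeight ν s = 0 := by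
  rw [poissonWeight, hs, sub_self, Real.zero_rpow (by linarith)]

lemma poissonWeight_succ (hν : 1 / 2 ≤ ν) {s : ℝ} (hs : s ∈ Set.Icc (-1 : ℝ) 1) :
    poissonWeight (ν + 1) s = (1 - s ^ 2) * poissonWeight ν s := by
  have h0 : 0 ≤ 1 - s ^ 2 := by nlinarith [hs.1, hs.2]
  rw [poissonWeight, poissonWeight, show ν + 1 - 1 / 2 = 1 + (ν - 1 / 2) by ring,
    Real.rpow_add_of_nonneg h0 zero_le_one (by linarith), Real.rpow_one]

lemma hasDerivAt_poissonWeight_succ {s : ℝ} (hs : s ∈ Set.Ioo (-1 : ℝ) 1) :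
    HasDerivAt (poissonWeight (ν + 1)) (-(2 * ν + 1) * s * poissonWeight ν s) s := by
  have hpos : 0 < 1 - s ^ 2 := by nlinarith [hs.1, hs.2]
  have h : HasDerivAt (fun s : ℝ => 1 - s ^ 2) (-(2 * s)) s := by
    simpa using ((hasDerivAt_id s).pow 2).const_sub 1
  refine (h.rpow_const (p := ν + 1 - 1 / 2) (Or.inl hpos.ne')).congr_deriv ?_
  rw [poissonWeight, show ν + 1 - 1 / 2 - 1 = ν - 1 / 2 by ring]
  ring

lemma integral_poissonWeight_by_parts {E : Type*} [NormedAddCommGroup E] [NormedSpace ℝ E]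
    [CompleteSpace E] (hν : 1 / 2 ≤ ν) {f f' : ℝ → E} (hf : ∀ s, HasDerivAt f (f' s) s)
    (hf' : Continuous f') :
    ∫ s in (-1 : ℝ)..1, poissonWeight ν s • (1 - s ^ 2) • f' s =
      (2 * ν + 1) • ∫ s in (-1 : ℝ)..1, poissonWeight ν s • s • f s := by
  have hcont : Continuous f := continuous_iff_continuousAt.2 fun s => (hf s).continuousAt
  have hν' : 1 / 2 ≤ ν + 1 := by linarith
  have hboundary := intervalIntegral.integral_eq_sub_of_hasDerivAt_of_le (a := -1) (b := 1)
    (f := fun s => poissonWeight (ν + 1) s • f s)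
    (f' := fun s => poissonWeight ν s • (1 - s ^ 2) • f' s
      - (2 * ν + 1) • poissonWeight ν s • s • f s) (by norm_num)
    (Continuous.continuousOn (by fun_prop (disch := assumption))) (fun s hs => ?_)
    (Continuous.intervalIntegrable (by fun_prop (disch := assumption)) _ _)
  · rw [intervalIntegral.integral_sub
      (Continuous.intervalIntegrable (by fun_prop (disch := assumption)) _ _)
      (Continuous.intervalIntegrable (by fun_prop (disch := assumption)) _ _),
      intervalIntegral.integral_smul, poissonWeight_eq_zero (by linarith) (by norm_num),
      poissonWeight_eq_zero (by linarith) (by norm_num), zero_smul, zero_smul,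
      sub_zero] at hboundary
    exact sub_eq_zero.1 hboundary
  · refine ((hasDerivAt_poissonWeight_succ hs).smul (hf s)).congr_deriv ?_
    rw [poissonWeight_succ hν ⟨hs.1.le, hs.2.le⟩]
    module

lemma integral_pow_mul_poissonWeight_succ (hν : 1 / 2 ≤ ν) (k : ℕ) :
    2 * (ν + k + 1) * ∫ s in (-1 : ℝ)..1, s ^ (2 * (k + 1)) * poissonWeight ν s =
      (2 * k + 1) * ∫ s in (-1 : ℝ)..1, s ^ (2 * k) * poissonWeight ν s := by
  have hint (n : ℕ) : IntervalIntegrable (fun s => s ^ n * poissonWeight ν s) volume (-1) 1 :=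
    Continuous.intervalIntegrable (by fun_prop (disch := assumption)) _ _
  have hparts := integral_poissonWeight_by_parts hν
    (fun s => hasDerivAt_pow (2 * k + 1) s) (by fun_prop)
  have hleft : ∀ s : ℝ, poissonWeight ν s • (1 - s ^ 2) • (((2 * k + 1 : ℕ) : ℝ) * s ^ (2 * k)) =
      (2 * k + 1) * (s ^ (2 * k) * poissonWeight ν s)
        - (2 * k + 1) * (s ^ (2 * (k + 1)) * poissonWeight ν s) := by
    intro s; simp only [smul_eq_mul]; push_cast; ring
  have hright : ∀ s : ℝ, poissonWeight ν s • s • s ^ (2 * k + 1) =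
      s ^ (2 * (k + 1)) * poissonWeight ν s := by
    intro s; simp only [smul_eq_mul]; ring
  simp only [Nat.add_sub_cancel, hleft, hright] at hparts
  rw [intervalIntegral.integral_sub ((hint _).const_mul _) ((hint _).const_mul _),
    intervalIntegral.integral_const_mul, intervalIntegral.integral_const_mul, smul_eq_mul] at hparts
  linear_combination -hparts

lemma beta_eq_integral {a b : ℝ} (ha : 0 < a) (hb : 0 < b) :
    ProbabilityTheory.beta a b = ∫ u in (0 : ℝ)..1, u ^ (a - 1) * (1 - u) ^ (b - 1) := by
  rw [ProbabilityTheory.beta_eq_betaIntegralReal a b ha hb, betaIntegral,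
    ← ofReal_re (∫ u in (0 : ℝ)..1, _), ← intervalIntegral.integral_ofReal]
  congr 1
  refine intervalIntegral.integral_congr fun u hu => ?_
  rw [Set.uIcc_of_le zero_le_one] at hu
  simp only [ofReal_mul, ofReal_cpow hu.1, ofReal_cpow (sub_nonneg.2 hu.2), ofReal_sub, ofReal_one]

lemma integral_poissonWeight_eq_beta (hν : -1 / 2 < ν) :
    ∫ s in (-1 : ℝ)..1, poissonWeight ν s =
      2 ^ (2 * ν) * ProbabilityTheory.beta (ν + 1 / 2) (ν + 1 / 2) := by
  have hsubst : ∫ s in (-1 : ℝ)..1, poissonWeight ν s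
      = 2 * ∫ u in (0 : ℝ)..1, poissonWeight ν (2 * u + -1) := by
    rw [intervalIntegral.integral_comp_mul_add _ two_ne_zero, smul_eq_mul,
      mul_inv_cancel_left₀ two_ne_zero]
    norm_num
  rw [hsubst, beta_eq_integral (by linarith) (by linarith), ← intervalIntegral.integral_const_mul,
    ← intervalIntegral.integral_const_mul]
  refine intervalIntegral.integral_congr fun u hu => ?_
  rw [Set.uIcc_of_le zero_le_one] at hu
  have hu' : 0 ≤ 1 - u := sub_nonneg.2 hu.2
  have hpow : (2 : ℝ) ^ (2 * ν) = 2 * 4 ^ (ν - 1 / 2) := by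
    rw [show (4 : ℝ) = 2 ^ (2 : ℝ) by norm_num, ← Real.rpow_mul zero_le_two,
      show 2 * ν = 1 + 2 * (ν - 1 / 2) by ring, Real.rpow_add two_pos, Real.rpow_one]
  simp only [poissonWeight]
  rw [show 1 - (2 * u + -1) ^ 2 = 4 * (u * (1 - u)) by ring, Real.mul_rpow (by norm_num)
    (mul_nonneg hu.1 hu'), Real.mul_rpow hu.1 hu', hpow, show ν + 1 / 2 - 1 = ν - 1 / 2 by ring,
    mul_assoc]

lemma integral_poissonWeight (hν : -1 / 2 < ν) :
    ∫ s in (-1 : ℝ)..1, poissonWeight ν s = poissonConst ν / Real.Gamma (ν + 1) := by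
  have hduplication := Real.Gamma_mul_Gamma_add_half (ν + 1 / 2)
  rw [show ν + 1 / 2 + 1 / 2 = ν + 1 by ring, show 2 * (ν + 1 / 2) = 2 * ν + 1 by ring,
    show 1 - (2 * ν + 1) = -(2 * ν) by ring, Real.rpow_neg zero_le_two] at hduplication
  have hΓ₁ : Real.Gamma (ν + 1) ≠ 0 := (Real.Gamma_pos_of_pos (by linarith)).ne'
  have hΓ₂ : Real.Gamma (2 * ν + 1) ≠ 0 := (Real.Gamma_pos_of_pos (by linarith)).ne'
  have h2 : (2 : ℝ) ^ (2 * ν) ≠ 0 := by positivity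
  rw [integral_poissonWeight_eq_beta hν, ProbabilityTheory.beta, poissonConst,
    show ν + 1 / 2 + (ν + 1 / 2) = 2 * ν + 1 by ring, eq_div_iff hΓ₁]
  generalize Real.Gamma (ν + 1 / 2) = a at hduplication ⊢
  generalize Real.Gamma (2 * ν + 1) = b at hduplication hΓ₂ ⊢
  generalize (2 : ℝ) ^ (2 * ν) = c at hduplication h2 ⊢
  field_simp at hduplication ⊢
  linear_combination a * hduplication

lemma integral_pow_mul_poissonWeight (hν : 1 / 2 ≤ ν) (k : ℕ) :
    ∫ s in (-1 : ℝ)..1, s ^ (2 * k) * poissonWeight ν s =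
      poissonConst ν * (2 * k).factorial / (k.factorial * Real.Gamma (ν + k + 1) * 4 ^ k) := by
  induction k with
  | zero => simp [integral_poissonWeight (show -1 / 2 < ν by linarith)]
  | succ k ih =>
    have hrec := integral_pow_mul_poissonWeight_succ hν k
    have hpos : 0 < ν + k + 1 := by positivity
    have hΓ : Real.Gamma (ν + k + 1) ≠ 0 := (Real.Gamma_pos_of_pos hpos).ne'
    have hΓ_succ : Real.Gamma (ν + (k + 1 : ℕ) + 1) = (ν + k + 1) * Real.Gamma (ν + k + 1) := by
      rw [← Real.Gamma_add_one hpos.ne', Nat.cast_succ, ← add_assoc]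
    rw [ih] at hrec
    rw [hΓ_succ, show 2 * (k + 1) = 2 * k + 1 + 1 by ring, Nat.factorial_succ, Nat.factorial_succ,
      Nat.factorial_succ, show 2 * k + 1 + 1 = 2 * (k + 1) by ring]
    push_cast
    refine mul_left_cancel₀ (show 2 * (ν + k + 1) ≠ 0 by positivity) (hrec.trans ?_)
    field_simp
    ring

lemma fourierLaplace_poissonWeight_eq_integral_cos (hν : 1 / 2 ≤ ν) (w : ℂ) :
    fourierLaplace (fun s => (poissonWeight ν s : ℂ)) w =
      ∫ s in (-1 : ℝ)..1, (poissonWeight ν s : ℂ) * cos (w * s) := by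
  have hint : ∀ c : ℂ, IntervalIntegrable (fun s : ℝ => (poissonWeight ν s : ℂ) * exp (c * w * s))
      volume (-1) 1 := fun c =>
    Continuous.intervalIntegrable (by fun_prop (disch := assumption)) _ _
  have hreflect : ∫ s in (-1 : ℝ)..1, (poissonWeight ν s : ℂ) * exp (-I * w * s) =
      ∫ s in (-1 : ℝ)..1, (poissonWeight ν s : ℂ) * exp (I * w * s) := by
    simpa [poissonWeight_neg] using intervalIntegral.integral_comp_neg (a := -1) (b := 1)
      (fun s : ℝ => (poissonWeight ν s : ℂ) * exp (I * w * s))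
  have hcos : ∀ s : ℝ, (poissonWeight ν s : ℂ) * cos (w * s) =
      ((poissonWeight ν s : ℂ) * exp (I * w * s) + (poissonWeight ν s : ℂ) * exp (-I * w * s)) /
        2 := by
    intro s
    rw [cos, show w * s * I = I * w * s by ring, show -(w * s) * I = -I * w * s by ring]
    ring
  simp only [hcos]
  rw [intervalIntegral.integral_div, intervalIntegral.integral_add (hint _) (hint _), hreflect,
    add_self_div_two, fourierLaplace]

lemma hasSum_integral_poissonWeight_mul_cos (hν : 1 / 2 ≤ ν) (w : ℂ) :
    HasSum (fun k : ℕ => ∫ s in (-1 : ℝ)..1, (poissonWeight ν s : ℂ) *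
        ((-1) ^ k * (w * s) ^ (2 * k) / ((2 * k).factorial : ℂ)))
      (∫ s in (-1 : ℝ)..1, (poissonWeight ν s : ℂ) * cos (w * s)) := by
  refine intervalIntegral.hasSum_integral_of_dominated_convergence
    (fun k s => ‖poissonWeight ν s‖ * (‖w‖ ^ (2 * k) / (2 * k).factorial))
    (fun k => Continuous.aestronglyMeasurable (by fun_prop (disch := assumption)))
    (fun k => .of_forall fun s hs => ?_) (.of_forall fun s _ => ?_) ?_
    (.of_forall fun s _ => (hasSum_cos _).mul_left _)
  · have hws : ‖w * s‖ ≤ ‖w‖ := by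
      simpa using mul_le_of_le_one_right (norm_nonneg w) (abs_le_one_of_mem_uIoc hs)
    rw [norm_mul, norm_real, norm_div, norm_mul, norm_pow, norm_neg, norm_one, one_pow, one_mul,
      norm_pow, norm_natCast]
    gcongr
  · exact ((Real.summable_pow_div_factorial ‖w‖).comp_injective
      (mul_right_injective₀ (two_ne_zero (α := ℕ)))).mul_left _
  · simp only [tsum_mul_left]
    exact Continuous.intervalIntegrable (by fun_prop (disch := assumption)) _ _

lemma integral_poissonWeight_mul_pow (hν : 1 / 2 ≤ ν) (w : ℂ) (k : ℕ) :
    ∫ s in (-1 : ℝ)..1, (poissonWeight ν s : ℂ) *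
        ((-1) ^ k * (w * s) ^ (2 * k) / ((2 * k).factorial : ℂ)) =
      poissonConst ν *
        ((-1) ^ k / ((k.factorial : ℂ) * Gamma ((ν : ℂ) + k + 1)) * (w / 2) ^ (2 * k)) := by
  have hfactor : ∀ s : ℝ, (poissonWeight ν s : ℂ) *
      ((-1) ^ k * (w * s) ^ (2 * k) / ((2 * k).factorial : ℂ)) =
      (-1) ^ k * w ^ (2 * k) / ((2 * k).factorial : ℂ) *
        ((s ^ (2 * k) * poissonWeight ν s : ℝ) : ℂ) := by
    intro s; push_cast; ring
  have hΓ : Gamma ((ν : ℂ) + k + 1) = (Real.Gamma (ν + k + 1) : ℝ) := by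
    rw [← Gamma_ofReal]; push_cast; rfl
  have hfactorial : ((2 * k).factorial : ℂ) ≠ 0 := by exact_mod_cast Nat.factorial_ne_zero _
  simp only [hfactor]
  rw [intervalIntegral.integral_const_mul, intervalIntegral.integral_ofReal,
    integral_pow_mul_poissonWeight hν, hΓ, div_pow, pow_mul 2 2 k]
  push_cast
  field_simp
  norm_num

theorem besselEntire_eq_fourierLaplace (hν : 1 / 2 ≤ ν) (w : ℂ) :
    besselEntire ν w =
      (poissonConst ν : ℂ)⁻¹ * fourierLaplace (fun s => (poissonWeight ν s : ℂ)) w := by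
  have hne : (poissonConst ν : ℂ) ≠ 0 :=
    ofReal_ne_zero.2 (poissonConst_pos (by linarith)).ne'
  have hsum := hasSum_integral_poissonWeight_mul_cos hν w
  simp only [integral_poissonWeight_mul_pow hν] at hsum
  rw [fourierLaplace_poissonWeight_eq_integral_cos hν, ← hsum.tsum_eq, tsum_mul_left,
    inv_mul_cancel_left₀ hne, besselEntire]

lemma hasDerivAt_besselEntire (hν : 1 / 2 ≤ ν) (w : ℂ) :
    HasDerivAt (besselEntire ν)
      ((poissonConst ν : ℂ)⁻¹ * fourierLaplace (fun s => poissonWeight ν s * (I * s)) w) w := by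
  rw [funext (besselEntire_eq_fourierLaplace hν)]
  exact (hasDerivAt_fourierLaplace (by fun_prop (disch := assumption)) w).const_mul _

lemma differentiable_besselEntire (hν : 1 / 2 ≤ ν) : Differentiable ℂ (besselEntire ν) :=
  fun w => (hasDerivAt_besselEntire hν w).differentiableAt

lemma deriv_besselEntire (hν : 1 / 2 ≤ ν) : deriv (besselEntire ν) = fun w =>
    (poissonConst ν : ℂ)⁻¹ * fourierLaplace (fun s => poissonWeight ν s * (I * s)) w :=
  deriv_eq (hasDerivAt_besselEntire hν)

lemma deriv_deriv_besselEntire (hν : 1 / 2 ≤ ν) (w : ℂ) : deriv (deriv (besselEntire ν)) w =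
    (poissonConst ν : ℂ)⁻¹ * fourierLaplace (fun s => poissonWeight ν s * (I * s) * (I * s)) w := by
  rw [deriv_besselEntire hν]
  exact ((hasDerivAt_fourierLaplace (by fun_prop (disch := assumption)) w).const_mul _).deriv

theorem besselEntire_ode (hν : 1 / 2 ≤ ν) (w : ℂ) :
    w * deriv (deriv (besselEntire ν)) w + (2 * ν + 1) * deriv (besselEntire ν) w +
      w * besselEntire ν w = 0 := by
  have hexp (s : ℝ) : HasDerivAt (fun s : ℝ => -I * exp (I * w * s)) (w * exp (I * w * s)) s := by
    have h : HasDerivAt (fun s : ℂ => I * w * s) (I * w) s := by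
      simpa using (hasDerivAt_id (s : ℂ)).const_mul (I * w)
    refine (h.cexp.comp_ofReal.const_mul (-I)).congr_deriv ?_
    linear_combination (-(w * exp (I * w * s))) * I_sq
  have hparts := integral_poissonWeight_by_parts hν hexp (by fun_prop)
  have hint (f : ℝ → ℂ) (hf : Continuous f) :
      IntervalIntegrable (fun s : ℝ => f s * exp (I * w * s)) volume (-1) 1 :=
    Continuous.intervalIntegrable (by fun_prop) _ _
  have hleft : ∀ s : ℝ, poissonWeight ν s • (1 - s ^ 2) • (w * exp (I * w * s)) =
      w * (poissonWeight ν s * exp (I * w * s)) +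
        w * (poissonWeight ν s * (I * s) * (I * s) * exp (I * w * s)) := by
    intro s
    simp only [real_smul]
    push_cast
    linear_combination (-poissonWeight ν s * s ^ 2 * w * exp (I * w * s)) * I_sq
  have hright : ∀ s : ℝ, poissonWeight ν s • s • (-I * exp (I * w * s)) =
      -(poissonWeight ν s * (I * s) * exp (I * w * s)) := by
    intro s
    simp only [real_smul]
    ring
  simp only [hleft, hright] at hparts
  rw [intervalIntegral.integral_add
    ((hint _ (by fun_prop (disch := assumption))).const_mul _)
    ((hint _ (by fun_prop (disch := assumption))).const_mul _),
    intervalIntegral.integral_const_mul, intervalIntegral.integral_const_mul,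
    intervalIntegral.integral_neg, real_smul] at hparts
  rw [deriv_deriv_besselEntire hν, deriv_besselEntire hν, besselEntire_eq_fourierLaplace hν]
  simp only [fourierLaplace]
  push_cast at hparts
  linear_combination (poissonConst ν : ℂ)⁻¹ * hparts

end PoissonRepresentation

section PowerFactor

variable {c w : ℂ} {g : ℂ → ℂ}

lemma hasDerivAt_cpow_mul (hg : DifferentiableAt ℂ g w) (hw : w ∈ slitPlane) :
    HasDerivAt (fun w => w ^ c * g w) (w ^ c * (c / w * g w + deriv g w)) w := by
  refine (((hasDerivAt_id w).cpow_const (c := c) hw).mul hg.hasDerivAt).congr_deriv ?_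
  simp only [id, cpow_sub _ _ (slitPlane_ne_zero hw), cpow_one]
  ring

lemma hasDerivAt_deriv_cpow_mul (hg : Differentiable ℂ g) (hg' : DifferentiableAt ℂ (deriv g) w)
    (hw : w ∈ slitPlane) :
    HasDerivAt (deriv fun w => w ^ c * g w)
      (w ^ c * (c * (c - 1) / w ^ 2 * g w + 2 * c / w * deriv g w + deriv (deriv g) w)) w := by
  have hw0 := slitPlane_ne_zero hw
  have hderiv : deriv (fun w => w ^ c * g w) =ᶠ[𝓝 w] fun w => w ^ c * (c / w * g w + deriv g w) :=
    (isOpen_slitPlane.eventually_mem hw).mono fun v hv => (hasDerivAt_cpow_mul (hg v) hv).deriv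
  have hbracket : HasDerivAt (fun w => c / w * g w + deriv g w)
      (-c / w ^ 2 * g w + c / w * deriv g w + deriv (deriv g) w) w := by
    have hinv := (hasDerivAt_inv hw0).const_mul c
    refine ((hinv.mul (hg w).hasDerivAt).add hg'.hasDerivAt).congr_deriv ?_
    ring
  refine ((hasDerivAt_cpow_mul hbracket.differentiableAt hw).congr_of_eventuallyEq
    hderiv).congr_deriv ?_
  rw [hbracket.deriv]
  field_simp
  ring

lemma exists_norm_cpow_mul_le {μ : ℝ} (hμ : 0 ≤ μ) (hg : Differentiable ℂ g) :
    ∃ C, 0 ≤ C ∧ ∀ w ∈ slitPlane, ‖w‖ ≤ 1 →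
      ‖w ^ (μ : ℂ) * g w‖ ≤ C * ‖w‖ ^ (μ - 1) ∧
        ‖deriv (fun w => w ^ (μ : ℂ) * g w) w‖ ≤ C * ‖w‖ ^ (μ - 1) := by
  have hbound {f : ℂ → ℂ} (hf : Continuous f) : ∃ C, ∀ w : ℂ, ‖w‖ ≤ 1 → ‖f w‖ ≤ C := by
    simpa using (isCompact_closedBall (0 : ℂ) 1).exists_bound_of_continuousOn hf.continuousOn
  obtain ⟨C₀, hC₀⟩ := hbound hg.continuous
  obtain ⟨C₁, hC₁⟩ := hbound (hg.contDiff (n := 1).continuous_deriv_one)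
  have hC₀_nonneg : 0 ≤ C₀ := (norm_nonneg _).trans (hC₀ 0 (by simp))
  have hC₁_nonneg : 0 ≤ C₁ := (norm_nonneg _).trans (hC₁ 0 (by simp))
  refine ⟨(μ + 1) * C₀ + C₁, by positivity, fun w hw hw1 => ?_⟩
  have hpos : 0 < ‖w‖ := norm_pos_iff.2 (slitPlane_ne_zero hw)
  have hpow : ‖w‖ ^ μ = ‖w‖ ^ (μ - 1) * ‖w‖ := by
    rw [← Real.rpow_add_one hpos.ne', sub_add_cancel]
  have hscale : ‖w‖ * ‖(μ : ℂ) / w * g w + deriv g w‖ ≤ μ * C₀ + C₁ :=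
    calc ‖w‖ * ‖(μ : ℂ) / w * g w + deriv g w‖
        ≤ ‖w‖ * (μ / ‖w‖ * ‖g w‖ + ‖deriv g w‖) := by
          gcongr
          refine (norm_add_le _ _).trans_eq ?_
          rw [norm_mul, norm_div, norm_real, Real.norm_of_nonneg hμ]
      _ = μ * ‖g w‖ + ‖w‖ * ‖deriv g w‖ := by field_simp
      _ ≤ μ * C₀ + 1 * C₁ := by gcongr; exacts [hC₀ w hw1, hC₁ w hw1]
      _ = μ * C₀ + C₁ := by rw [one_mul]
  rw [(hasDerivAt_cpow_mul (hg w) hw).deriv, norm_mul, norm_mul, norm_cpow_real, hpow, mul_assoc,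
    mul_assoc, mul_comm _ (‖w‖ ^ (μ - 1))]
  constructor
  · gcongr
    nlinarith [hC₀ w hw1, norm_nonneg (g w)]
  · gcongr
    linarith

end PowerFactor

/-- The entire function `g` such that `e^{iw} √w J_ν(w) = w^{ν + 1/2} g(w)`. -/
def modBesselFactor (ν : ℝ) (w : ℂ) : ℂ := 2 ^ (-ν : ℂ) * (exp (I * w) * besselEntire ν w)

/-- The modulated Bessel function `H_ν(w) = e^{iw} √w J_ν(w)`, with the principal branch of the
power. -/
def modBessel (ν : ℝ) (w : ℂ) : ℂ := w ^ ((ν + 1 / 2 : ℝ) : ℂ) * modBesselFactor ν w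

/-- The combination `2i H_ν - H_ν'`, whose derivative is `O(|w|⁻²)` wherever `H_ν` is bounded. -/
def modBesselTail (ν : ℝ) (w : ℂ) : ℂ := 2 * I * modBessel ν w - deriv (modBessel ν) w

/-- The closed first quadrant without the origin. -/
def quadrant : Set ℂ := {w | 0 ≤ w.re ∧ 0 ≤ w.im ∧ w ≠ 0}

lemma quadrant_subset_slitPlane : quadrant ⊆ slitPlane := by
  rintro w ⟨hre, -, hne⟩
  rw [mem_slitPlane_iff]
  rcases hre.lt_or_eq with h | h
  · exact Or.inl h
  · exact Or.inr fun h' => hne (ext h.symm h')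

lemma ofReal_mul_mem_quadrant {w : ℂ} (hw : w ∈ quadrant) {r : ℝ} (hr : 0 < r) :
    (r : ℂ) * w ∈ quadrant := by
  refine ⟨?_, ?_, mul_ne_zero (ofReal_ne_zero.2 hr.ne') hw.2.2⟩
  · simpa using mul_nonneg hr.le hw.1
  · simpa using mul_nonneg hr.le hw.2.1

lemma I_mem_quadrant : I ∈ quadrant := by simp [quadrant]

lemma ofReal_mem_quadrant {r : ℝ} (hr : 0 < r) : (r : ℂ) ∈ quadrant := by
  simpa [quadrant, hr.ne'] using hr.le

section ModBessel

variable {ν : ℝ} {w : ℂ}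

lemma hasDerivAt_modBesselFactor (hν : 1 / 2 ≤ ν) (w : ℂ) :
    HasDerivAt (modBesselFactor ν)
      (2 ^ (-ν : ℂ) * (exp (I * w) * (I * besselEntire ν w + deriv (besselEntire ν) w))) w := by
  have hexp : HasDerivAt (fun w => exp (I * w)) (exp (I * w) * I) w := by
    simpa using ((hasDerivAt_id w).const_mul I).cexp
  refine ((hexp.mul (differentiable_besselEntire hν w).hasDerivAt).const_mul _).congr_deriv ?_
  ring

lemma differentiable_modBesselFactor (hν : 1 / 2 ≤ ν) : Differentiable ℂ (modBesselFactor ν) :=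
  fun w => (hasDerivAt_modBesselFactor hν w).differentiableAt

lemma modBesselFactor_ode (hν : 1 / 2 ≤ ν) (w : ℂ) :
    w * deriv (deriv (modBesselFactor ν)) w +
      (2 * ν + 1 - 2 * I * w) * deriv (modBesselFactor ν) w -
        (2 * ν + 1) * I * modBesselFactor ν w = 0 := by
  have hexp : HasDerivAt (fun w => exp (I * w)) (exp (I * w) * I) w := by
    simpa using ((hasDerivAt_id w).const_mul I).cexp
  have hΦ := differentiable_besselEntire hν
  have hderiv : HasDerivAt (fun w => 2 ^ (-ν : ℂ) *
      (exp (I * w) * (I * besselEntire ν w + deriv (besselEntire ν) w))) _ w :=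
    (hexp.mul (((hΦ w).hasDerivAt.const_mul I).add (hΦ.deriv w).hasDerivAt)).const_mul _
  rw [deriv_eq (hasDerivAt_modBesselFactor hν), hderiv.deriv]
  simp only [Pi.add_apply, modBesselFactor]
  linear_combination (2 ^ (-ν : ℂ) * exp (I * w)) * besselEntire_ode hν w -
    (2 ^ (-ν : ℂ) * exp (I * w) * w * besselEntire ν w) * I_sq

lemma differentiableAt_modBessel (hν : 1 / 2 ≤ ν) (hw : w ∈ slitPlane) :
    DifferentiableAt ℂ (modBessel ν) w :=
  (hasDerivAt_cpow_mul (differentiable_modBesselFactor hν w) hw).differentiableAt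

theorem hasDerivAt_deriv_modBessel (hν : 1 / 2 ≤ ν) (hw : w ∈ slitPlane) :
    HasDerivAt (deriv (modBessel ν))
      (2 * I * deriv (modBessel ν) w + ((ν ^ 2 - 1 / 4 : ℝ) : ℂ) / w ^ 2 * modBessel ν w) w := by
  have hg := differentiable_modBesselFactor hν
  have hw0 := slitPlane_ne_zero hw
  have hode := modBesselFactor_ode hν w
  have hfirst : deriv (modBessel ν) w = _ :=
    (hasDerivAt_cpow_mul (c := ((ν + 1 / 2 : ℝ) : ℂ)) (hg w) hw).deriv
  refine (hasDerivAt_deriv_cpow_mul (c := ((ν + 1 / 2 : ℝ) : ℂ)) hg (hg.deriv w) hw).congr_deriv ?_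
  rw [hfirst, modBessel]
  generalize w ^ ((ν + 1 / 2 : ℝ) : ℂ) = p
  push_cast
  field_simp
  linear_combination (16 * p * w) * hode

lemma hasDerivAt_modBesselTail (hν : 1 / 2 ≤ ν) (hw : w ∈ slitPlane) :
    HasDerivAt (modBesselTail ν) (-(((ν ^ 2 - 1 / 4 : ℝ) : ℂ) / w ^ 2 * modBessel ν w)) w := by
  refine (((differentiableAt_modBessel hν hw).hasDerivAt.const_mul (2 * I)).sub
    (hasDerivAt_deriv_modBessel hν hw)).congr_deriv ?_
  ring

lemma exists_norm_modBessel_le_rpow (hν : 1 / 2 ≤ ν) :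
    ∃ C, 0 ≤ C ∧ ∀ w ∈ slitPlane, ‖w‖ ≤ 1 →
      ‖modBessel ν w‖ ≤ C * ‖w‖ ^ (ν - 1 / 2) ∧
        ‖deriv (modBessel ν) w‖ ≤ C * ‖w‖ ^ (ν - 1 / 2) := by
  have h := exists_norm_cpow_mul_le (μ := ν + 1 / 2) (by linarith)
    (differentiable_modBesselFactor hν)
  rwa [show ν + 1 / 2 - 1 = ν - 1 / 2 by ring] at h

lemma two_mul_norm_modBessel_le (ν : ℝ) (w : ℂ) :
    2 * ‖modBessel ν w‖ ≤ ‖deriv (modBessel ν) w‖ + ‖modBesselTail ν w‖ :=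
  calc 2 * ‖modBessel ν w‖ = ‖deriv (modBessel ν) w + modBesselTail ν w‖ := by
        simp [modBesselTail]
    _ ≤ _ := norm_add_le _ _

end ModBessel

section Energy

/-- Grönwall's inequality in differential form with the integrating factor `exp (-φ)`. -/
lemma le_exp_mul_of_deriv_le {E E' φ φ' : ℝ → ℝ} {a r : ℝ}
    (hE : ∀ s, a ≤ s → HasDerivAt E (E' s) s) (hφ : ∀ s, a ≤ s → HasDerivAt φ (φ' s) s)
    (hle : ∀ s, a ≤ s → E' s ≤ φ' s * E s) (hr : a ≤ r) :
    E r ≤ Real.exp (φ r - φ a) * E a := by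
  have hprod (s : ℝ) (hs : a ≤ s) : HasDerivAt (fun s => E s * Real.exp (-φ s))
      (E' s * Real.exp (-φ s) + E s * (Real.exp (-φ s) * -φ' s)) s :=
    (hE s hs).mul (hφ s hs).neg.exp
  have hanti : AntitoneOn (fun s => E s * Real.exp (-φ s)) (Set.Ici a) := by
    refine antitoneOn_of_hasDerivWithinAt_nonpos (convex_Ici a)
      (fun s hs => (hprod s hs).continuousAt.continuousWithinAt)
      (fun s hs => (hprod s (interior_subset hs)).hasDerivWithinAt) fun s hs => ?_
    nlinarith [hle s (interior_subset hs), Real.exp_pos (-φ s)]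
  calc E r = E r * Real.exp (-φ r) * Real.exp (φ r) := by
        rw [mul_assoc, ← Real.exp_add, neg_add_cancel, Real.exp_zero, mul_one]
    _ ≤ E a * Real.exp (-φ a) * Real.exp (φ r) :=
        mul_le_mul_of_nonneg_right (hanti Set.self_mem_Ici hr hr) (Real.exp_pos _).le
    _ = Real.exp (φ r - φ a) * E a := by
        rw [mul_assoc, ← Real.exp_add, neg_add_eq_sub, mul_comm]

lemma real_inner_mul_self_right (a u : ℂ) : inner ℝ u (a * u) = a.re * ‖u‖ ^ 2 := by
  rw [Complex.inner, Complex.sq_norm, normSq_apply]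
  simp only [mul_re, mul_im, conj_re, conj_im]
  ring

lemma energy_deriv_le {a u v q : ℂ} {c : ℝ} (ha : a.re ≤ 0) (hq : 2 * ‖q‖ ≤ c * (‖u‖ + ‖v‖)) :
    2 * inner ℝ u (a * u + q) + 2 * inner ℝ v (-q) ≤ 2 * c * (‖u‖ ^ 2 + ‖v‖ ^ 2) := by
  have hdissipation : a.re * ‖u‖ ^ 2 ≤ 0 := mul_nonpos_of_nonpos_of_nonneg ha (by positivity)
  have huq := real_inner_le_norm u q
  have hvq := neg_le_of_abs_le (abs_real_inner_le_norm v q)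
  rw [inner_add_right, real_inner_mul_self_right, inner_neg_right]
  rcases le_or_gt 0 c with hc | hc
  · nlinarith [mul_le_mul_of_nonneg_right hq (add_nonneg (norm_nonneg u) (norm_nonneg v)),
      mul_nonneg hc (sq_nonneg (‖u‖ - ‖v‖))]
  · have hu : ‖u‖ = 0 := by nlinarith [norm_nonneg q, norm_nonneg u, norm_nonneg v]
    have hv : ‖v‖ = 0 := by nlinarith [norm_nonneg q, norm_nonneg u, norm_nonneg v]
    simp only [hu, hv] at huq hvq ⊢
    linarith

lemma hasDerivAt_comp_ray {f : ℂ → ℂ} {f' w : ℂ} {r : ℝ} (hf : HasDerivAt f f' (r * w)) :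
    HasDerivAt (fun r : ℝ => f (r * w)) (w * f') r := by
  have h : HasDerivAt (fun z : ℂ => z * w) w (r : ℂ) := by
    simpa using (hasDerivAt_id (r : ℂ)).mul_const w
  exact ((hf.comp (r : ℂ) h).congr_deriv (mul_comm _ _)).comp_ofReal

/-- The energy `|H_ν'|² + |2i H_ν - H_ν'|²`. -/
def modBesselEnergy (ν : ℝ) (w : ℂ) : ℝ :=
  ‖deriv (modBessel ν) w‖ ^ 2 + ‖modBesselTail ν w‖ ^ 2

variable {ν : ℝ} {w : ℂ}

lemma modBesselEnergy_ray_le (hν : 1 / 2 ≤ ν) (hw : w ∈ quadrant) (hw1 : ‖w‖ = 1) {r : ℝ}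
    (hr : 1 ≤ r) :
    modBesselEnergy ν (r * w) ≤ Real.exp (2 * (ν ^ 2 - 1 / 4)) * modBesselEnergy ν w := by
  set lam : ℝ := ν ^ 2 - 1 / 4 with hlam
  have hlam0 : 0 ≤ lam := by nlinarith
  have hφ (s : ℝ) (hs : 1 ≤ s) : HasDerivAt (fun s : ℝ => -(2 * lam * s⁻¹)) (2 * (lam / s ^ 2)) s :=
    ((hasDerivAt_inv (by positivity)).const_mul (2 * lam)).neg.congr_deriv (by ring)
  have hgronwall := le_exp_mul_of_deriv_le (E := fun s => modBesselEnergy ν (s * w)) (fun s hs =>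
    have hs' := quadrant_subset_slitPlane (ofReal_mul_mem_quadrant hw (one_pos.trans_le hs))
    (hasDerivAt_comp_ray (hasDerivAt_deriv_modBessel hν hs')).norm_sq.add
      (hasDerivAt_comp_ray (hasDerivAt_modBesselTail hν hs')).norm_sq) hφ (fun s hs => ?_) hr
  · rw [ofReal_one, one_mul] at hgronwall
    have hE : 0 ≤ modBesselEnergy ν w := by unfold modBesselEnergy; positivity
    refine hgronwall.trans ?_
    gcongr
    have : 0 ≤ lam * r⁻¹ := by positivity
    linarith
  · have hq : 2 * ‖w * ((lam : ℂ) / (s * w) ^ 2 * modBessel ν (s * w))‖ ≤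
        lam / s ^ 2 * (‖deriv (modBessel ν) (s * w)‖ + ‖modBesselTail ν (s * w)‖) := by
      calc _ = lam / s ^ 2 * (2 * ‖modBessel ν (s * w)‖) := by
            simp only [norm_mul, norm_div, norm_pow, hw1, norm_real, Real.norm_of_nonneg hlam0,
              Real.norm_of_nonneg (one_pos.trans_le hs).le]
            ring
        _ ≤ _ := by gcongr; exact two_mul_norm_modBessel_le ν _
    have ha : (2 * I * w).re ≤ 0 := by simpa using hw.2.1
    refine le_of_eq_of_le ?_ (energy_deriv_le ha hq)
    congr 3
    · ring
    · ring

lemma modBesselEnergy_le {C : ℝ} (h : ‖modBessel ν w‖ ≤ C) (h' : ‖deriv (modBessel ν) w‖ ≤ C) :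
    modBesselEnergy ν w ≤ 10 * C ^ 2 := by
  have htail : ‖modBesselTail ν w‖ ≤ 3 * C :=
    calc ‖modBesselTail ν w‖ ≤ ‖2 * I * modBessel ν w‖ + ‖deriv (modBessel ν) w‖ := norm_sub_le _ _
      _ ≤ 3 * C := by
        rw [norm_mul, norm_mul, norm_I, norm_ofNat]
        linarith
  calc modBesselEnergy ν w ≤ C ^ 2 + (3 * C) ^ 2 := by unfold modBesselEnergy; gcongr
    _ = 10 * C ^ 2 := by ring

lemma norm_modBessel_le_sqrt_energy (ν : ℝ) (w : ℂ) :
    ‖modBessel ν w‖ ≤ √(modBesselEnergy ν w) ∧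
      ‖deriv (modBessel ν) w‖ ≤ √(modBesselEnergy ν w) := by
  have hderiv : ‖deriv (modBessel ν) w‖ ≤ √(modBesselEnergy ν w) :=
    Real.le_sqrt_of_sq_le (le_add_of_nonneg_right (sq_nonneg _))
  have htail : ‖modBesselTail ν w‖ ≤ √(modBesselEnergy ν w) :=
    Real.le_sqrt_of_sq_le (le_add_of_nonneg_left (sq_nonneg _))
  exact ⟨by linarith [two_mul_norm_modBessel_le ν w], hderiv⟩

theorem exists_norm_modBessel_le (hν : 1 / 2 ≤ ν) :
    ∃ C, ∀ w ∈ quadrant, ‖modBessel ν w‖ ≤ C ∧ ‖deriv (modBessel ν) w‖ ≤ C := by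
  obtain ⟨C, hC, h⟩ := exists_norm_modBessel_le_rpow hν
  have hdisk (w : ℂ) (hw : w ∈ quadrant) (hw1 : ‖w‖ ≤ 1) :
      ‖modBessel ν w‖ ≤ C ∧ ‖deriv (modBessel ν) w‖ ≤ C := by
    have hpow := mul_le_of_le_one_right hC
      (Real.rpow_le_one (norm_nonneg w) hw1 (sub_nonneg.2 hν))
    have hw' := h w (quadrant_subset_slitPlane hw) hw1
    exact ⟨hw'.1.trans hpow, hw'.2.trans hpow⟩
  set D := √(Real.exp (2 * (ν ^ 2 - 1 / 4)) * (10 * C ^ 2))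
  refine ⟨max C D, fun w hw => ?_⟩
  rcases le_total ‖w‖ 1 with hw1 | hw1
  · exact (hdisk w hw hw1).imp (le_max_of_le_left ·) (le_max_of_le_left ·)
  · have hpos : 0 < ‖w‖ := one_pos.trans_le hw1
    set v : ℂ := ((‖w‖⁻¹ : ℝ) : ℂ) * w
    have hv : v ∈ quadrant := ofReal_mul_mem_quadrant hw (by positivity)
    have hv1 : ‖v‖ = 1 := by
      rw [norm_mul, norm_real, norm_inv, norm_norm, inv_mul_cancel₀ hpos.ne']
    have hwv : (‖w‖ : ℂ) * v = w := by
      rw [← mul_assoc, ← ofReal_mul, mul_inv_cancel₀ hpos.ne', ofReal_one, one_mul]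
    have henergy : modBesselEnergy ν w ≤ Real.exp (2 * (ν ^ 2 - 1 / 4)) * (10 * C ^ 2) := by
      have hray := modBesselEnergy_ray_le hν hv hv1 hw1
      rw [hwv] at hray
      refine hray.trans ?_
      gcongr
      exact modBesselEnergy_le (hdisk v hv hv1.le).1 (hdisk v hv hv1.le).2
    have hsqrt := Real.sqrt_le_sqrt henergy
    exact (norm_modBessel_le_sqrt_energy ν w).imp
      (fun h => le_max_of_le_right (h.trans hsqrt)) (fun h => le_max_of_le_right (h.trans hsqrt))

end Energy

section ImaginaryAxis

variable {ν : ℝ}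

lemma rpow_mul_integral_poissonWeight (ν : ℝ) {r : ℝ} (hr : 0 < r) :
    r ^ (ν + 1 / 2) * ∫ s in (-1 : ℝ)..1, poissonWeight ν s * Real.exp (-(r * (1 + s))) =
      ∫ x in (0 : ℝ)..(2 * r), Real.exp (-x) * x ^ (ν - 1 / 2) * (2 - x / r) ^ (ν - 1 / 2) := by
  have hsubst : ∫ s in (-1 : ℝ)..1, poissonWeight ν s * Real.exp (-(r * (1 + s))) =
      r⁻¹ * ∫ x in (0 : ℝ)..(2 * r), poissonWeight ν (r⁻¹ * x + -1) * Real.exp (-x) := by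
    have h := intervalIntegral.integral_comp_mul_add (a := 0) (b := 2 * r)
      (fun s => poissonWeight ν s * Real.exp (-(r * (1 + s)))) (inv_ne_zero hr.ne') (-1)
    rw [inv_inv, mul_zero, zero_add, mul_comm 2 r, inv_mul_cancel_left₀ hr.ne',
      show (2 : ℝ) + -1 = 1 by norm_num, mul_comm r 2] at h
    rw [← inv_mul_cancel_left₀ hr.ne' (∫ s in (-1 : ℝ)..1, _), ← smul_eq_mul r, ← h]
    simp only [add_neg_cancel_comm_assoc, mul_inv_cancel_left₀ hr.ne']
  rw [hsubst, ← mul_assoc, ← intervalIntegral.integral_const_mul]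
  refine intervalIntegral.integral_congr fun x hx => ?_
  rw [Set.uIcc_of_le (by positivity)] at hx
  have hxr : 0 ≤ 2 - x / r := sub_nonneg.2 ((div_le_iff₀ hr).2 hx.2)
  have hweight : poissonWeight ν (r⁻¹ * x + -1) =
      x ^ (ν - 1 / 2) / r ^ (ν - 1 / 2) * (2 - x / r) ^ (ν - 1 / 2) := by
    rw [poissonWeight, ← Real.div_rpow hx.1 hr.le, ← Real.mul_rpow (div_nonneg hx.1 hr.le) hxr]
    congr 1
    ring
  have hpow : r ^ (ν + 1 / 2) = r ^ (ν - 1 / 2) * r := by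
    rw [← Real.rpow_add_one hr.ne']
    congr 1
    ring
  simp only [hweight, hpow]
  field_simp

lemma tendsto_rpow_mul_integral_poissonWeight (hν : 1 / 2 ≤ ν) :
    Tendsto (fun r : ℝ => r ^ (ν + 1 / 2) *
        ∫ s in (-1 : ℝ)..1, poissonWeight ν s * Real.exp (-(r * (1 + s)))) atTop
      (𝓝 (2 ^ (ν - 1 / 2) * Real.Gamma (ν + 1 / 2))) := by
  have hΓ_integrable : IntegrableOn (fun x : ℝ => Real.exp (-x) * x ^ (ν - 1 / 2)) (Set.Ioi 0) := by
    have h := Real.GammaIntegral_convergent (s := ν + 1 / 2) (by linarith)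
    rwa [show ν + 1 / 2 - 1 = ν - 1 / 2 by ring] at h
  have hΓ : 2 ^ (ν - 1 / 2) * Real.Gamma (ν + 1 / 2) =
      ∫ x in Set.Ioi (0 : ℝ), Real.exp (-x) * x ^ (ν - 1 / 2) * 2 ^ (ν - 1 / 2) := by
    rw [integral_mul_const, Real.Gamma_eq_integral (by linarith),
      show ν + 1 / 2 - 1 = ν - 1 / 2 by ring, mul_comm]
  have : 0 ≤ ν - 1 / 2 := by linarith
  rw [hΓ]
  refine Tendsto.congr' (f₁ := fun r => ∫ x in Set.Ioi (0 : ℝ), (Set.Ioc 0 (2 * r)).indicator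
    (fun x => Real.exp (-x) * x ^ (ν - 1 / 2) * (2 - x / r) ^ (ν - 1 / 2)) x)
    ((eventually_gt_atTop 0).mono fun r hr => ?_)
    (tendsto_integral_filter_of_dominated_convergence
      (fun x => Real.exp (-x) * x ^ (ν - 1 / 2) * 2 ^ (ν - 1 / 2))
      (.of_forall fun r => (Measurable.indicator (by fun_prop)
        measurableSet_Ioc).aestronglyMeasurable)
      ((eventually_gt_atTop 0).mono fun r hr => ?_) (hΓ_integrable.mul_const _) ?_)
  · beta_reduce
    rw [rpow_mul_integral_poissonWeight ν hr, setIntegral_indicator measurableSet_Ioc,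
      Set.inter_eq_right.2 Set.Ioc_subset_Ioi_self,
      ← intervalIntegral.integral_of_le (by positivity)]
  · filter_upwards [ae_restrict_mem measurableSet_Ioi] with x (hx : 0 < x)
    by_cases hmem : x ∈ Set.Ioc 0 (2 * r)
    · have hxr : 0 ≤ 2 - x / r := sub_nonneg.2 ((div_le_iff₀ hr).2 hmem.2)
      rw [Set.indicator_of_mem hmem, Real.norm_of_nonneg (by positivity)]
      gcongr
      exact sub_le_self _ (by positivity)
    · rw [Set.indicator_of_notMem hmem, norm_zero]
      positivity
  · filter_upwards [ae_restrict_mem measurableSet_Ioi] with x (hx : 0 < x)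
    have hbase : Tendsto (fun r : ℝ => 2 - x / r) atTop (𝓝 2) := by
      simpa using (tendsto_const_nhds (x := (2 : ℝ))).sub
        ((tendsto_const_nhds (x := x)).div_atTop tendsto_id)
    refine ((hbase.rpow_const (Or.inl two_ne_zero)).const_mul _).congr'
      ((eventually_gt_atTop x).mono fun r hr => ?_)
    beta_reduce
    rw [Set.indicator_of_mem (show x ∈ Set.Ioc 0 (2 * r) from ⟨hx, by linarith⟩)]

lemma cpow_ofReal_mul {r : ℝ} (hr : 0 < r) {z : ℂ} (hz : z ≠ 0) (c : ℂ) :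
    ((r : ℂ) * z) ^ c = (r : ℂ) ^ c * z ^ c := by
  have hr' : (r : ℂ) ≠ 0 := ofReal_ne_zero.2 hr.ne'
  rw [cpow_def_of_ne_zero (mul_ne_zero hr' hz), log_ofReal_mul hr hz, ofReal_log hr.le,
    cpow_def_of_ne_zero hr', cpow_def_of_ne_zero hz, ← exp_add, add_mul]

lemma exp_mul_besselEntire_imaginary (hν : 1 / 2 ≤ ν) (r : ℝ) :
    exp (I * (r * I)) * besselEntire ν (r * I) = (((poissonConst ν)⁻¹ *
      ∫ s in (-1 : ℝ)..1, poissonWeight ν s * Real.exp (-(r * (1 + s))) : ℝ) : ℂ) := by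
  rw [besselEntire_eq_fourierLaplace hν, fourierLaplace, mul_left_comm, ofReal_mul, ofReal_inv,
    ← intervalIntegral.integral_const_mul, ← intervalIntegral.integral_ofReal]
  congr 1
  refine intervalIntegral.integral_congr fun s _ => ?_
  have hexp : exp (I * (r * I)) * exp (I * (r * I) * s) = exp (-(r * (1 + s))) := by
    rw [← exp_add]
    congr 1
    linear_combination (r * (1 + s) : ℂ) * I_sq
  simp only [ofReal_mul, ofReal_exp, ofReal_neg, ofReal_add, ofReal_one, ← hexp]
  ring

/-- The limit `i^{ν + 1/2} / √(2π)` of `e^{iw} √w J_ν(w)` along the imaginary axis. -/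
def modBesselLimit (ν : ℝ) : ℂ := I ^ ((ν + 1 / 2 : ℝ) : ℂ) / (√(2 * π) : ℝ)

lemma two_rpow_mul_poissonConst_inv (hν : -1 / 2 < ν) :
    2 ^ (-ν) * (poissonConst ν)⁻¹ * (2 ^ (ν - 1 / 2) * Real.Gamma (ν + 1 / 2)) =
      (√(2 * π))⁻¹ := by
  have hΓ : Real.Gamma (ν + 1 / 2) ≠ 0 := (Real.Gamma_pos_of_pos (by linarith)).ne'
  have hpow : (2 : ℝ) ^ (-ν) * 2 ^ (ν - 1 / 2) = (√2)⁻¹ := by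
    rw [← Real.rpow_add two_pos, Real.sqrt_eq_rpow, ← Real.rpow_neg two_pos.le]
    congr 1
    ring
  rw [poissonConst, Real.sqrt_mul two_pos.le, mul_inv (√2), ← hpow]
  generalize Real.Gamma (ν + 1 / 2) = Γ at hΓ ⊢
  field_simp

lemma tendsto_modBessel_imaginary (hν : 1 / 2 ≤ ν) :
    Tendsto (fun r : ℝ => modBessel ν (r * I)) atTop (𝓝 (modBesselLimit ν)) := by
  have hlim := ((tendsto_rpow_mul_integral_poissonWeight hν).const_mul
    (2 ^ (-ν) * (poissonConst ν)⁻¹)).ofReal.const_mul (I ^ ((ν + 1 / 2 : ℝ) : ℂ))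
  rw [two_rpow_mul_poissonConst_inv (by linarith), ofReal_inv,
    ← div_eq_mul_inv (I ^ _)] at hlim
  refine hlim.congr' ((eventually_gt_atTop 0).mono fun r hr => ?_)
  beta_reduce
  rw [modBessel, modBesselFactor, exp_mul_besselEntire_imaginary hν, cpow_ofReal_mul hr I_ne_zero,
    ← ofReal_cpow hr.le, ofReal_mul, ofReal_mul, ofReal_mul, ofReal_mul,
    ofReal_cpow zero_le_two, ofReal_neg, ofReal_ofNat]
  ring

end ImaginaryAxis

section RealAxis

lemma exists_limit_of_norm_deriv_le {E : Type*} [NormedAddCommGroup E] [NormedSpace ℝ E]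
    [CompleteSpace E] {f f' : ℝ → E} {C : ℝ} (hf : ∀ r, 1 ≤ r → HasDerivAt f (f' r) r)
    (hC : ∀ r, 1 ≤ r → ‖f' r‖ ≤ C / r ^ 2) : ∃ L, ∀ r, 1 ≤ r → ‖f r - L‖ ≤ C / r := by
  have hpow (x : ℝ) : C * x ^ (-2 : ℝ) = C / x ^ 2 := by
    rw [← Nat.cast_ofNat, Real.rpow_neg_natCast, zpow_neg, zpow_natCast, div_eq_mul_inv]
  have hmajorant {r : ℝ} (hr : 1 ≤ r) :
      IntegrableOn (fun x : ℝ => C * x ^ (-2 : ℝ)) (Set.Ioi r) :=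
    (integrableOn_Ioi_rpow_of_lt (by norm_num) (one_pos.trans_le hr)).const_mul C
  have hbound {r : ℝ} (hr : 1 ≤ r) :
      ∀ᵐ x ∂volume.restrict (Set.Ioi r), ‖f' x‖ ≤ C * x ^ (-2 : ℝ) := by
    filter_upwards [ae_restrict_mem measurableSet_Ioi] with x hx
    exact (hpow x).symm ▸ hC x (hr.trans hx.le)
  have hint : IntegrableOn f' (Set.Ioi 1) := by
    refine (hmajorant le_rfl).mono' ?_ (hbound le_rfl)
    refine (stronglyMeasurable_deriv f).aestronglyMeasurable.congr ?_
    filter_upwards [ae_restrict_mem measurableSet_Ioi] with x hx using (hf x hx.le).deriv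
  refine ⟨limUnder atTop f, fun r hr => ?_⟩
  have hlim := tendsto_limUnder_of_hasDerivAt_of_integrableOn_Ioi (fun x hx => hf x hx.le) hint
  calc ‖f r - limUnder atTop f‖ = ‖∫ x in Set.Ioi r, f' x‖ := by
        rw [norm_sub_rev, integral_Ioi_of_hasDerivAt_of_tendsto'
          (fun x hx => hf x (hr.trans hx)) (hint.mono_set (Set.Ioi_subset_Ioi hr)) hlim]
    _ ≤ ∫ x in Set.Ioi r, C * x ^ (-2 : ℝ) :=
        norm_integral_le_of_norm_le (hmajorant hr) (hbound hr)
    _ = C / r := by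
        rw [integral_const_mul, integral_Ioi_rpow_of_lt (by norm_num) (by positivity),
          show (-2 : ℝ) + 1 = -1 by norm_num, Real.rpow_neg_one]
        ring

lemma limit_deriv_eq_zero {E : Type*} [NormedAddCommGroup E] [NormedSpace ℝ E] {f f' : ℝ → E}
    {a m : E} (hf : ∀ᶠ r in atTop, HasDerivAt f (f' r) r)
    (ha : Tendsto f atTop (𝓝 a)) (hm : Tendsto f' atTop (𝓝 m)) : m = 0 := by
  have hstep : Tendsto (fun r => f (r + 1) - f r) atTop (𝓝 0) := by
    simpa using (ha.comp (tendsto_atTop_add_const_right _ 1 tendsto_id)).sub ha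
  refine tendsto_nhds_unique ?_ hstep
  refine Metric.tendsto_atTop.2 fun ε hε => ?_
  obtain ⟨N, hN⟩ := Metric.tendsto_atTop.1 hm (ε / 2) (half_pos hε)
  obtain ⟨N', hN'⟩ := eventually_atTop.1 hf
  refine ⟨max N N', fun r hr => ?_⟩
  have hmean := norm_image_sub_le_of_norm_deriv_le_segment' (f := fun x => f x - x • m)
    (f' := fun x => f' x - m) (C := ε / 2) (a := r) (b := r + 1)
    (fun x hx => ((hN' x ((le_max_right _ _).trans (hr.trans hx.1))).sub
      (by simpa using (hasDerivAt_id x).smul_const m)).hasDerivWithinAt)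
    (fun x hx => (dist_eq_norm (f' x) m ▸
      hN x ((le_max_left _ _).trans (hr.trans hx.1))).le)
    (r + 1) (Set.right_mem_Icc.2 (by linarith))
  rw [show f (r + 1) - (r + 1) • m - (f r - r • m) = f (r + 1) - f r - m by module] at hmean
  rw [dist_eq_norm]
  linarith

variable {ν C : ℝ}

lemma norm_div_sq_mul_modBessel_le (hν : 1 / 2 ≤ ν) {w : ℂ} (hw : ‖modBessel ν w‖ ≤ C) :
    ‖((ν ^ 2 - 1 / 4 : ℝ) : ℂ) / w ^ 2 * modBessel ν w‖ ≤ (ν ^ 2 - 1 / 4) * C / ‖w‖ ^ 2 := by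
  have hlam : 0 ≤ ν ^ 2 - 1 / 4 := by nlinarith
  rw [norm_mul, norm_div, norm_pow, norm_real, Real.norm_of_nonneg hlam, div_mul_eq_mul_div]
  gcongr

lemma norm_modBesselTail_sub_le (hν : 1 / 2 ≤ ν) (hC : ∀ w ∈ quadrant, ‖modBessel ν w‖ ≤ C)
    {r : ℝ} (hr : 0 < r) :
    ‖modBesselTail ν r - modBesselTail ν (r * I)‖ ≤ 8 * (ν ^ 2 - 1 / 4) * C / r := by
  have hlam : 0 ≤ ν ^ 2 - 1 / 4 := by nlinarith
  have hC0 : 0 ≤ C := (norm_nonneg _).trans (hC I I_mem_quadrant)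
  -- a convex set containing `r` and `ri` which stays at distance `r / 2` from the origin
  let s : Set ℂ := {w | 0 ≤ w.re} ∩ {w | 0 ≤ w.im} ∩ {w | r ≤ w.re + w.im}
  have hconv : Convex ℝ s := by
    refine ((convex_halfSpace_re_ge 0).inter (convex_halfSpace_im_ge 0)).inter ?_
    exact convex_halfSpace_ge (f := fun w : ℂ => w.re + w.im)
      ⟨fun x y => by simp; ring, fun c x => by simp; ring⟩ r
  have hnorm : ∀ w ∈ s, r / 2 ≤ ‖w‖ := fun w hw => by
    have hsum : r ≤ w.re + w.im := hw.2
    linarith [re_le_norm w, (le_abs_self _).trans (abs_im_le_norm w)]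
  have hquadrant : s ⊆ quadrant := fun w hw =>
    ⟨hw.1.1, hw.1.2, norm_pos_iff.1 ((half_pos hr).trans_le (hnorm w hw))⟩
  have hmean := hconv.norm_image_sub_le_of_norm_hasDerivWithin_le (𝕜 := ℂ)
    (f := modBesselTail ν) (x := r * I) (y := (r : ℂ)) (C := (ν ^ 2 - 1 / 4) * C / (r / 2) ^ 2)
    (fun w hw => (hasDerivAt_modBesselTail hν
      (quadrant_subset_slitPlane (hquadrant hw))).hasDerivWithinAt)
    (fun w hw => ?_) (by simp [s, hr.le]) (by simp [s, hr.le])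
  · have hdist : ‖(r : ℂ) - r * I‖ ≤ 2 * r := by
      refine (norm_sub_le _ _).trans_eq ?_
      rw [norm_mul, norm_I, norm_real, Real.norm_of_nonneg hr.le]
      ring
    calc _ ≤ (ν ^ 2 - 1 / 4) * C / (r / 2) ^ 2 * ‖(r : ℂ) - r * I‖ := hmean
      _ ≤ (ν ^ 2 - 1 / 4) * C / (r / 2) ^ 2 * (2 * r) := by gcongr
      _ = 8 * (ν ^ 2 - 1 / 4) * C / r := by field_simp; ring
  · rw [norm_neg]
    refine (norm_div_sq_mul_modBessel_le hν (hC w (hquadrant hw))).trans ?_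
    have := hnorm w hw
    gcongr

lemma norm_modBesselTail_imaginary_sub_le (hν : 1 / 2 ≤ ν)
    (hC : ∀ w ∈ quadrant, ‖modBessel ν w‖ ≤ C) {r : ℝ} (hr : 1 ≤ r) :
    ‖modBesselTail ν (r * I) - 2 * I * modBesselLimit ν‖ ≤ (ν ^ 2 - 1 / 4) * C / r := by
  have hmem {r : ℝ} (hr : 0 < r) : (r : ℂ) * I ∈ quadrant :=
    ofReal_mul_mem_quadrant I_mem_quadrant hr
  have hnorm {r : ℝ} (hr : 0 < r) : ‖(r : ℂ) * I‖ = r := by simp [abs_of_pos hr]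
  obtain ⟨L, hL⟩ := exists_limit_of_norm_deriv_le (C := (ν ^ 2 - 1 / 4) * C)
    (f := fun r : ℝ => modBesselTail ν (r * I))
    (fun r hr => hasDerivAt_comp_ray (hasDerivAt_modBesselTail hν
      (quadrant_subset_slitPlane (hmem (one_pos.trans_le hr)))))
    (fun r hr => by
      have hpos := one_pos.trans_le hr
      have hle := norm_div_sq_mul_modBessel_le hν (hC _ (hmem hpos))
      rw [hnorm hpos] at hle
      rwa [norm_mul, norm_I, one_mul, norm_neg])
  have htail : Tendsto (fun r : ℝ => modBesselTail ν (r * I)) atTop (𝓝 L) :=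
    tendsto_iff_norm_sub_tendsto_zero.2 <| squeeze_zero' (.of_forall fun _ => norm_nonneg _)
      ((eventually_ge_atTop 1).mono hL) (tendsto_const_nhds.div_atTop tendsto_id)
  have hH := tendsto_modBessel_imaginary hν
  have hderiv := limit_deriv_eq_zero (f := fun r : ℝ => modBessel ν (r * I))
    (f' := fun r : ℝ => I * (2 * I * modBessel ν (r * I) - modBesselTail ν (r * I)))
    ((eventually_gt_atTop 0).mono fun r hr =>
      (hasDerivAt_comp_ray (differentiableAt_modBessel hν
        (quadrant_subset_slitPlane (hmem hr))).hasDerivAt).congr_deriv (by simp [modBesselTail]))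
    hH (((hH.const_mul (2 * I)).sub htail).const_mul I)
  rw [sub_eq_zero.1 ((mul_eq_zero.1 hderiv).resolve_left I_ne_zero)]
  exact hL r hr

lemma norm_modBesselTail_ofReal_sub_le (hν : 1 / 2 ≤ ν)
    (hC : ∀ w ∈ quadrant, ‖modBessel ν w‖ ≤ C) {r : ℝ} (hr : 1 ≤ r) :
    ‖modBesselTail ν r - 2 * I * modBesselLimit ν‖ ≤ 9 * (ν ^ 2 - 1 / 4) * C / r :=
  calc _ ≤ ‖modBesselTail ν r - modBesselTail ν (r * I)‖ +
        ‖modBesselTail ν (r * I) - 2 * I * modBesselLimit ν‖ := norm_sub_le_norm_sub_add_norm_sub ..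
    _ ≤ 8 * (ν ^ 2 - 1 / 4) * C / r + (ν ^ 2 - 1 / 4) * C / r := by
        gcongr
        · exact norm_modBesselTail_sub_le hν hC (one_pos.trans_le hr)
        · exact norm_modBesselTail_imaginary_sub_le hν hC hr
    _ = 9 * (ν ^ 2 - 1 / 4) * C / r := by ring

lemma norm_exp_two_I_mul (r : ℝ) : ‖exp (2 * I * r)‖ = 1 := by
  simp [norm_exp]

lemma exists_norm_deriv_modBessel_sub_le (hν : 1 / 2 ≤ ν)
    (hC : ∀ w ∈ quadrant, ‖modBessel ν w‖ ≤ C) :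
    ∃ D : ℂ, ∀ r : ℝ, 1 ≤ r →
      ‖deriv (modBessel ν) r - D * exp (2 * I * r)‖ ≤ (ν ^ 2 - 1 / 4) * C / r := by
  have hexp (z : ℂ) :
      HasDerivAt (fun z => exp (-(2 * I * z))) (exp (-(2 * I * z)) * -(2 * I)) z := by
    simpa using ((hasDerivAt_id z).const_mul (2 * I)).neg.cexp
  obtain ⟨D, hD⟩ := exists_limit_of_norm_deriv_le (C := (ν ^ 2 - 1 / 4) * C)
    (f := fun r : ℝ => exp (-(2 * I * r)) * deriv (modBessel ν) r)
    (f' := fun r : ℝ => exp (-(2 * I * r)) *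
      (((ν ^ 2 - 1 / 4 : ℝ) : ℂ) / (r : ℂ) ^ 2 * modBessel ν r))
    (fun r hr => ((hexp r).mul (hasDerivAt_deriv_modBessel hν (quadrant_subset_slitPlane
      (ofReal_mem_quadrant (one_pos.trans_le hr))))).comp_ofReal.congr_deriv (by ring))
    (fun r hr => by
      have hpos := one_pos.trans_le hr
      rw [norm_mul, exp_neg, norm_inv, norm_exp_two_I_mul, inv_one, one_mul]
      simpa [abs_of_pos hpos] using
        norm_div_sq_mul_modBessel_le hν (hC _ (ofReal_mem_quadrant hpos)))
  refine ⟨D, fun r hr => ?_⟩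
  have hphase : exp (2 * I * r) * exp (-(2 * I * r)) = 1 := by
    rw [← exp_add, add_neg_cancel, exp_zero]
  calc ‖deriv (modBessel ν) r - D * exp (2 * I * r)‖
      = ‖exp (2 * I * r) * (exp (-(2 * I * r)) * deriv (modBessel ν) r - D)‖ := by
        congr 1
        linear_combination -deriv (modBessel ν) r * hphase
    _ ≤ (ν ^ 2 - 1 / 4) * C / r := by
        rw [norm_mul, norm_exp_two_I_mul, one_mul]
        exact hD r hr

theorem exists_modBessel_asymptotics (hν : 1 / 2 ≤ ν) :
    ∃ (D : ℂ) (C : ℝ), ∀ r : ℝ, 1 ≤ r →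
      ‖modBessel ν r - (modBesselLimit ν + D * exp (2 * I * r))‖ ≤ C / r := by
  obtain ⟨C, hC⟩ := exists_norm_modBessel_le hν
  obtain ⟨D, hD⟩ := exists_norm_deriv_modBessel_sub_le hν fun w hw => (hC w hw).1
  refine ⟨D / (2 * I), 5 * (ν ^ 2 - 1 / 4) * C, fun r hr => ?_⟩
  have htail := norm_modBesselTail_ofReal_sub_le hν (fun w hw => (hC w hw).1) hr
  have hsplit : 2 * I * (modBessel ν r - (modBesselLimit ν + D / (2 * I) * exp (2 * I * r))) =
      (modBesselTail ν r - 2 * I * modBesselLimit ν) +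
        (deriv (modBessel ν) r - D * exp (2 * I * r)) := by
    rw [modBesselTail]
    field_simp
    ring
  have hnorm := (congrArg norm hsplit).trans_le (norm_add_le _ _)
  rw [norm_mul, norm_mul, norm_ofNat, norm_I, mul_one] at hnorm
  have hsum : 5 * (ν ^ 2 - 1 / 4) * C / r =
      (9 * (ν ^ 2 - 1 / 4) * C / r + (ν ^ 2 - 1 / 4) * C / r) / 2 := by ring
  linarith [hD r hr]

end RealAxis

section Fresnel

/-- The primitive eighth root of unity `e^{iπ/4}`: the rotation by it turns the oscillating
phase `e^{iτ²}` into the Gaussian `e^{-ρ²}`. -/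
def eighthRoot : ℂ := exp (I * (π / 4 : ℝ))

lemma eighthRoot_eq : eighthRoot = (√2 / 2 : ℝ) + (√2 / 2 : ℝ) * I := by
  rw [eighthRoot, mul_comm, exp_mul_I, ← ofReal_cos, ← ofReal_sin, Real.cos_pi_div_four,
    Real.sin_pi_div_four]

lemma eighthRoot_sq : eighthRoot ^ 2 = I := by
  rw [eighthRoot, ← exp_nat_mul, show ((2 : ℕ) : ℂ) * (I * (π / 4 : ℝ)) = π / 2 * I by
    push_cast; ring, exp_pi_div_two_mul_I]

lemma norm_eighthRoot : ‖eighthRoot‖ = 1 := by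
  rw [eighthRoot, mul_comm, norm_exp_ofReal_mul_I]

/-- The integrand `e^{i(s + ζρ)² - is²}`, `ζ = e^{iπ/4}`, of the Fresnel integral over the ray
from `s` in the direction `ζ`, without the phase at `s`. -/
def fresnelIntegrand (s ρ : ℝ) : ℂ :=
  exp (-(ρ : ℂ) ^ 2 + 2 * I * eighthRoot * s * ρ)

lemma fresnelIntegrand_zero_left (ρ : ℝ) : fresnelIntegrand 0 ρ = (Real.exp (-1 * ρ ^ 2) : ℝ) := by
  simp [fresnelIntegrand]

lemma fresnelIntegrand_zero_right (s : ℝ) : fresnelIntegrand s 0 = 1 := by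
  simp [fresnelIntegrand]

lemma norm_fresnelIntegrand (s ρ : ℝ) :
    ‖fresnelIntegrand s ρ‖ = Real.exp (-ρ ^ 2 - √2 * s * ρ) := by
  rw [fresnelIntegrand, norm_exp, eighthRoot_eq]
  congr 1
  simp [pow_two]
  ring

lemma norm_fresnelIntegrand_le {s c : ℝ} (hs : |s| ≤ c) (ρ : ℝ) :
    ‖fresnelIntegrand s ρ‖ ≤ Real.exp (c ^ 2) * Real.exp (-(1 / 2) * ρ ^ 2) := by
  rw [norm_fresnelIntegrand, ← Real.exp_add]
  refine Real.exp_le_exp.2 ?_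
  have hsqrt : √2 ^ 2 = 2 := Real.sq_sqrt two_pos.le
  have hsq : s ^ 2 ≤ c ^ 2 := sq_le_sq.2 (hs.trans (le_abs_self c))
  nlinarith [sq_nonneg (√2 * s + ρ)]

lemma continuous_fresnelIntegrand (s : ℝ) : Continuous (fresnelIntegrand s) := by
  unfold fresnelIntegrand
  fun_prop

lemma integrable_fresnelIntegrand (s : ℝ) : Integrable (fresnelIntegrand s) :=
  ((integrable_exp_neg_mul_sq (by norm_num)).const_mul _).mono'
    (continuous_fresnelIntegrand s).aestronglyMeasurable
    (.of_forall (norm_fresnelIntegrand_le le_rfl))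

lemma tendsto_fresnelIntegrand (s : ℝ) : Tendsto (fresnelIntegrand s) atTop (𝓝 0) := by
  have hexponent : Tendsto (fun ρ : ℝ => -(1 / 2) * ρ ^ 2) atTop atBot :=
    (tendsto_pow_atTop two_ne_zero).const_mul_atTop_of_neg (by norm_num)
  refine squeeze_zero_norm (norm_fresnelIntegrand_le le_rfl) ?_
  simpa only [mul_zero, Function.comp_def] using
    (Real.tendsto_exp_atBot.comp hexponent).const_mul (Real.exp (|s| ^ 2))

lemma hasDerivAt_fresnelIntegrand_left (s ρ : ℝ) :
    HasDerivAt (fun s => fresnelIntegrand s ρ)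
      (2 * I * eighthRoot * ρ * fresnelIntegrand s ρ) s := by
  have h : HasDerivAt (fun s : ℂ => -(ρ : ℂ) ^ 2 + 2 * I * eighthRoot * s * ρ)
      (2 * I * eighthRoot * ρ) s := by
    simpa using (((hasDerivAt_id (s : ℂ)).const_mul (2 * I * eighthRoot)).mul_const
      (ρ : ℂ)).const_add (-(ρ : ℂ) ^ 2)
  exact h.cexp.comp_ofReal.congr_deriv (mul_comm _ _)

lemma hasDerivAt_fresnelIntegrand_right (s ρ : ℝ) :
    HasDerivAt (fresnelIntegrand s)
      ((2 * I * eighthRoot * s - 2 * ρ) * fresnelIntegrand s ρ) ρ := by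
  have h : HasDerivAt (fun ρ : ℂ => -ρ ^ 2 + 2 * I * eighthRoot * s * ρ)
      (2 * I * eighthRoot * s - 2 * ρ) (ρ : ℂ) :=
    ((hasDerivAt_pow 2 (ρ : ℂ)).neg.add ((hasDerivAt_id (ρ : ℂ)).const_mul
      (2 * I * eighthRoot * s))).congr_deriv (by simp; ring)
  exact h.cexp.comp_ofReal.congr_deriv (mul_comm _ _)

/-- The complementary Fresnel integral `∫ₛ^∞ e^{iτ²} dτ`, taken over the rotated ray and without
its phase `e^{is²}`. -/
def fresnelTail (s : ℝ) : ℂ := eighthRoot * ∫ ρ in Set.Ioi (0 : ℝ), fresnelIntegrand s ρ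

lemma hasDerivAt_integral_fresnelIntegrand (s : ℝ) :
    IntegrableOn (fun ρ : ℝ => 2 * I * eighthRoot * ρ * fresnelIntegrand s ρ) (Set.Ioi 0) ∧
    HasDerivAt (fun s => ∫ ρ in Set.Ioi (0 : ℝ), fresnelIntegrand s ρ)
      (∫ ρ in Set.Ioi (0 : ℝ), 2 * I * eighthRoot * ρ * fresnelIntegrand s ρ) s := by
  refine hasDerivAt_integral_of_dominated_loc_of_deriv_le
    (bound := fun ρ => 2 * Real.exp ((|s| + 1) ^ 2) * (ρ * Real.exp (-(1 / 2) * ρ ^ 2)))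
    (Metric.ball_mem_nhds s one_pos)
    (.of_forall fun s => (continuous_fresnelIntegrand s).aestronglyMeasurable)
    (integrable_fresnelIntegrand s).integrableOn
    (Continuous.aestronglyMeasurable (by have := continuous_fresnelIntegrand s; fun_prop)) ?_
    ((integrable_mul_exp_neg_mul_sq (by norm_num)).const_mul _).integrableOn
    (.of_forall fun ρ s' _ => hasDerivAt_fresnelIntegrand_left s' ρ)
  filter_upwards [ae_restrict_mem measurableSet_Ioi] with ρ (hρ : 0 < ρ) s' hs'
  have hs : |s'| ≤ |s| + 1 := by
    have hdist : |s' - s| < 1 := hs'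
    linarith [abs_sub_abs_le_abs_sub s' s]
  calc ‖2 * I * eighthRoot * ρ * fresnelIntegrand s' ρ‖ = 2 * ρ * ‖fresnelIntegrand s' ρ‖ := by
        simp [norm_eighthRoot, abs_of_pos hρ]
    _ ≤ 2 * ρ * (Real.exp ((|s| + 1) ^ 2) * Real.exp (-(1 / 2) * ρ ^ 2)) := by
        gcongr
        exact norm_fresnelIntegrand_le hs ρ
    _ = _ := by ring

lemma hasDerivAt_fresnelTail (s : ℝ) :
    HasDerivAt fresnelTail (-1 - 2 * I * s * fresnelTail s) s := by
  obtain ⟨hint', hderiv⟩ := hasDerivAt_integral_fresnelIntegrand s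
  have hint := (integrable_fresnelIntegrand s).integrableOn (s := Set.Ioi 0)
  have hsplit (ρ : ℝ) : (2 * I * eighthRoot * s - 2 * ρ) * fresnelIntegrand s ρ =
      2 * I * eighthRoot * s * fresnelIntegrand s ρ +
        eighthRoot * (2 * I * eighthRoot * ρ * fresnelIntegrand s ρ) := by
    linear_combination (-2 * I * ρ * fresnelIntegrand s ρ) * eighthRoot_sq
      - 2 * ρ * fresnelIntegrand s ρ * I_sq
  have hparts := integral_Ioi_of_hasDerivAt_of_tendsto' (a := (0 : ℝ))
    (fun ρ _ => hasDerivAt_fresnelIntegrand_right s ρ)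
    (by simp only [hsplit]; exact (hint.const_mul _).add (hint'.const_mul _))
    (tendsto_fresnelIntegrand s)
  simp only [hsplit] at hparts
  rw [integral_add (hint.const_mul _) (hint'.const_mul _), integral_const_mul,
    integral_const_mul, fresnelIntegrand_zero_right] at hparts
  refine (hderiv.const_mul eighthRoot).congr_deriv ?_
  rw [fresnelTail]
  linear_combination hparts

/-- The limit `e^{iπ/4} √π / 2` of the Fresnel integral at infinity. -/
def fresnelLimit : ℂ := eighthRoot * (√π / 2 : ℝ)

lemma norm_fresnelLimit : ‖fresnelLimit‖ = √π / 2 := by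
  rw [fresnelLimit, norm_mul, norm_eighthRoot, one_mul, norm_real,
    Real.norm_of_nonneg (by positivity)]

lemma fresnelTail_zero : fresnelTail 0 = fresnelLimit := by
  have hgauss := integral_gaussian_Ioi 1
  rw [div_one] at hgauss
  simp only [fresnelTail, fresnelLimit, fresnelIntegrand_zero_left]
  rw [integral_complex_ofReal, hgauss]

lemma norm_fresnelTail_le {s : ℝ} (hs : 0 ≤ s) : ‖fresnelTail s‖ ≤ √π / 2 := by
  have hgauss := integral_gaussian_Ioi 1
  rw [div_one] at hgauss
  rw [fresnelTail, norm_mul, norm_eighthRoot, one_mul, ← hgauss]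
  refine norm_integral_le_of_norm_le (integrable_exp_neg_mul_sq one_pos).integrableOn ?_
  filter_upwards [ae_restrict_mem measurableSet_Ioi] with ρ (hρ : 0 < ρ)
  rw [norm_fresnelIntegrand, neg_one_mul]
  exact Real.exp_le_exp.2 (sub_le_self _ (by positivity))

lemma norm_fresnelTail_le_inv {s : ℝ} (hs : 0 < s) : ‖fresnelTail s‖ ≤ (√2 * s)⁻¹ := by
  have hdecay : -(√2 * s) < 0 := neg_neg_of_pos (by positivity)
  calc ‖fresnelTail s‖ = ‖∫ ρ in Set.Ioi (0 : ℝ), fresnelIntegrand s ρ‖ := by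
        rw [fresnelTail, norm_mul, norm_eighthRoot, one_mul]
    _ ≤ ∫ ρ in Set.Ioi (0 : ℝ), Real.exp (-(√2 * s) * ρ) := by
        refine norm_integral_le_of_norm_le (integrableOn_exp_mul_Ioi hdecay 0) ?_
        refine .of_forall fun ρ => (norm_fresnelIntegrand s ρ).trans_le ?_
        exact Real.exp_le_exp.2 (by nlinarith [sq_nonneg ρ])
    _ = (√2 * s)⁻¹ := by
        rw [integral_exp_mul_Ioi hdecay, mul_zero, Real.exp_zero, neg_div_neg_eq, one_div]

lemma tendsto_fresnelTail : Tendsto fresnelTail atTop (𝓝 0) :=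
  squeeze_zero_norm' ((eventually_gt_atTop 0).mono fun _ => norm_fresnelTail_le_inv)
    (tendsto_inv_atTop_zero.comp (tendsto_id.const_mul_atTop (by positivity)))

lemma norm_exp_I_mul_sq (s : ℝ) : ‖exp (I * (s : ℂ) ^ 2)‖ = 1 := by
  rw [← ofReal_pow, mul_comm, norm_exp_ofReal_mul_I]

/-- The Fresnel integral `∫₀ˢ e^{iτ²} dτ`. -/
def fresnel (s : ℝ) : ℂ := ∫ τ in (0 : ℝ)..s, exp (I * (τ : ℂ) ^ 2)

lemma hasDerivAt_fresnel (s : ℝ) : HasDerivAt fresnel (exp (I * (s : ℂ) ^ 2)) s := by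
  have hcont : Continuous fun τ : ℝ => exp (I * (τ : ℂ) ^ 2) := by fun_prop
  exact hcont.integral_hasStrictDerivAt 0 s |>.hasDerivAt

lemma continuous_fresnel : Continuous fresnel :=
  continuous_iff_continuousAt.2 fun s => (hasDerivAt_fresnel s).continuousAt

lemma fresnel_zero : fresnel 0 = 0 := intervalIntegral.integral_same

lemma fresnel_neg (s : ℝ) : fresnel (-s) = -fresnel s := by
  have h := intervalIntegral.integral_comp_neg (a := (0 : ℝ)) (b := s)
    (fun τ : ℝ => exp (I * (τ : ℂ) ^ 2))
  simp only [ofReal_neg, neg_sq, neg_zero] at h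
  rw [fresnel, fresnel, h, intervalIntegral.integral_symm]

lemma fresnel_add_fresnelTail (s : ℝ) :
    fresnel s + exp (I * (s : ℂ) ^ 2) * fresnelTail s = fresnelLimit := by
  have hphase (s : ℝ) : HasDerivAt (fun s : ℝ => exp (I * (s : ℂ) ^ 2))
      (exp (I * (s : ℂ) ^ 2) * (I * (2 * s))) s :=
    (((hasDerivAt_pow 2 (s : ℂ)).const_mul I).cexp.comp_ofReal).congr_deriv (by simp)
  have hderiv (s : ℝ) : HasDerivAt (fun s : ℝ => fresnel s +
      exp (I * (s : ℂ) ^ 2) * fresnelTail s) 0 s :=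
    ((hasDerivAt_fresnel s).add ((hphase s).mul (hasDerivAt_fresnelTail s))).congr_deriv (by ring)
  have hconst := is_const_of_deriv_eq_zero (fun s => (hderiv s).differentiableAt)
    (fun s => (hderiv s).deriv) s 0
  simpa [fresnel_zero, fresnelTail_zero] using hconst

lemma norm_fresnel_le_of_nonneg {s : ℝ} (hs : 0 ≤ s) : ‖fresnel s‖ ≤ √π := by
  rw [eq_sub_of_add_eq (fresnel_add_fresnelTail s)]
  refine (norm_sub_le _ _).trans ?_
  rw [norm_mul, norm_exp_I_mul_sq, one_mul, norm_fresnelLimit]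
  linarith [norm_fresnelTail_le hs]

lemma norm_fresnel_le (s : ℝ) : ‖fresnel s‖ ≤ √π := by
  rcases le_total 0 s with hs | hs
  · exact norm_fresnel_le_of_nonneg hs
  · simpa [fresnel_neg] using norm_fresnel_le_of_nonneg (neg_nonneg.2 hs)

lemma tendsto_fresnel_atTop : Tendsto fresnel atTop (𝓝 fresnelLimit) := by
  have htail : Tendsto (fun s : ℝ => exp (I * (s : ℂ) ^ 2) * fresnelTail s) atTop (𝓝 0) := by
    rw [tendsto_zero_iff_norm_tendsto_zero]
    simpa [norm_exp_I_mul_sq] using tendsto_fresnelTail.norm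
  have hlim := htail.const_sub fresnelLimit
  rw [sub_zero] at hlim
  exact hlim.congr fun s => sub_eq_of_eq_add (fresnel_add_fresnelTail s).symm

lemma tendsto_fresnel_atBot : Tendsto fresnel atBot (𝓝 (-fresnelLimit)) := by
  simpa [Function.comp_def, fresnel_neg] using
    (tendsto_fresnel_atTop.comp tendsto_neg_atBot_atTop).neg

end Fresnel

section Concentration

lemma tendsto_fresnel_div (a : ℝ) :
    Tendsto (fun ε : ℝ => fresnel (a / ε)) (𝓝[>] 0) (𝓝 (SignType.sign a * fresnelLimit)) := by
  simp only [div_eq_mul_inv]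
  rcases lt_trichotomy a 0 with ha | rfl | ha
  · simpa [Function.comp_def, sign_neg ha] using
      tendsto_fresnel_atBot.comp (tendsto_inv_nhdsGT_zero.const_mul_atTop_of_neg ha)
  · simp [fresnel_zero]
  · simpa [Function.comp_def, sign_pos ha] using
      tendsto_fresnel_atTop.comp (tendsto_inv_nhdsGT_zero.const_mul_atTop ha)

variable {a b : ℝ} {φ φ' : ℝ → ℂ}

lemma integral_mul_fresnelKernel (hab : a ≤ b) (hφ : ContinuousOn φ (Set.Icc a b))
    (hφ' : IntervalIntegrable φ' volume a b) (hderiv : ∀ y ∈ Set.Ioo a b, HasDerivAt φ (φ' y) y)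
    (c ε : ℝ) :
    ∫ y in a..b, φ y * (ε⁻¹ * exp (I * (((y - c) / ε : ℝ) : ℂ) ^ 2)) =
      φ b * fresnel ((b - c) / ε) - φ a * fresnel ((a - c) / ε) -
        ∫ y in a..b, φ' y * fresnel ((y - c) / ε) := by
  have hprimitive (y : ℝ) : HasDerivAt (fun y : ℝ => fresnel ((y - c) / ε))
      (ε⁻¹ * exp (I * (((y - c) / ε : ℝ) : ℂ) ^ 2)) y := by
    have hinner : HasDerivAt (fun y : ℝ => (y - c) / ε) ε⁻¹ y := by
      simpa using ((hasDerivAt_id y).sub_const c).div_const ε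
    exact ((hasDerivAt_fresnel ((y - c) / ε)).scomp y hinner).congr_deriv real_smul
  refine intervalIntegral.integral_mul_deriv_eq_deriv_mul_of_hasDeriv_right
    (by rwa [Set.uIcc_of_le hab]) (fun y _ => (hprimitive y).continuousAt.continuousWithinAt)
    (fun y hy => ?_) (fun y _ => (hprimitive y).hasDerivWithinAt) hφ'
    (Continuous.intervalIntegrable (by fun_prop) _ _)
  rw [min_eq_left hab, max_eq_right hab] at hy
  exact (hderiv y hy).hasDerivWithinAt

lemma tendsto_integral_fresnelKernel_of_sign_eq (hab : a ≤ b) (hφ : ContinuousOn φ (Set.Icc a b))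
    (hφ' : IntervalIntegrable φ' volume a b) (hderiv : ∀ y ∈ Set.Ioo a b, HasDerivAt φ (φ' y) y)
    {c : ℝ} {σ : SignType} (hσ : ∀ y ∈ Set.Ioo a b, SignType.sign (y - c) = σ) :
    Tendsto (fun ε : ℝ => ∫ y in a..b, φ y * (ε⁻¹ * exp (I * (((y - c) / ε : ℝ) : ℂ) ^ 2)))
      (𝓝[>] 0) (𝓝 (((SignType.sign (b - c) - σ) * φ b - (SignType.sign (a - c) - σ) * φ a) *
        fresnelLimit)) := by
  have hlim : Tendsto (fun ε : ℝ => ∫ y in a..b, φ' y * fresnel ((y - c) / ε)) (𝓝[>] 0)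
      (𝓝 (∫ y in a..b, φ' y * (σ * fresnelLimit))) := by
    refine intervalIntegral.tendsto_integral_filter_of_dominated_convergence
      (fun y => ‖φ' y‖ * √π) (.of_forall fun ε => ?_)
      (.of_forall fun ε => .of_forall fun y _ => ?_) (hφ'.norm.mul_const _) ?_
    · exact hφ'.def'.aestronglyMeasurable.mul
        (continuous_fresnel.comp (by fun_prop)).aestronglyMeasurable
    · rw [norm_mul]
      gcongr
      exact norm_fresnel_le _
    · filter_upwards [Measure.ae_ne volume b] with y hyb hy
      rw [Set.uIoc_of_le hab] at hy
      rw [← hσ y ⟨hy.1, hy.2.lt_of_ne hyb⟩]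
      exact (tendsto_fresnel_div (y - c)).const_mul _
  have hFTC : ∫ y in a..b, φ' y = φ b - φ a :=
    intervalIntegral.integral_eq_sub_of_hasDerivAt_of_le hab hφ hderiv hφ'
  rw [intervalIntegral.integral_mul_const, hFTC] at hlim
  simp only [integral_mul_fresnelKernel hab hφ hφ' hderiv c]
  convert (((tendsto_fresnel_div (b - c)).const_mul (φ b)).sub
    ((tendsto_fresnel_div (a - c)).const_mul (φ a))).sub hlim using 2
  ring

lemma tendsto_integral_fresnelKernel_of_lt (hab : a ≤ b) (hφ : ContinuousOn φ (Set.Icc a b))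
    (hφ' : IntervalIntegrable φ' volume a b) (hderiv : ∀ y ∈ Set.Ioo a b, HasDerivAt φ (φ' y) y)
    {c : ℝ} (hc : c < a) :
    Tendsto (fun ε : ℝ => ∫ y in a..b, φ y * (ε⁻¹ * exp (I * (((y - c) / ε : ℝ) : ℂ) ^ 2)))
      (𝓝[>] 0) (𝓝 0) := by
  have hsign {y : ℝ} (hy : a ≤ y) : SignType.sign (y - c) = 1 := sign_pos (by linarith)
  simpa [hsign hab, hsign le_rfl] using
    tendsto_integral_fresnelKernel_of_sign_eq hab hφ hφ' hderiv fun y hy => hsign hy.1.le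

lemma tendsto_integral_fresnelKernel_of_mem (hφ : ContinuousOn φ (Set.Icc a b))
    (hφ' : IntervalIntegrable φ' volume a b) (hderiv : ∀ y ∈ Set.Ioo a b, HasDerivAt φ (φ' y) y)
    {c : ℝ} (hc : c ∈ Set.Ioo a b) :
    Tendsto (fun ε : ℝ => ∫ y in a..b, φ y * (ε⁻¹ * exp (I * (((y - c) / ε : ℝ) : ℂ) ^ 2)))
      (𝓝[>] 0) (𝓝 (2 * fresnelLimit * φ c)) := by
  have hmem : c ∈ Set.uIcc a b := Set.mem_uIcc_of_le hc.1.le hc.2.le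
  have hleft := tendsto_integral_fresnelKernel_of_sign_eq hc.1.le
    (hφ.mono (Set.Icc_subset_Icc_right hc.2.le))
    (hφ'.mono_set (Set.uIcc_subset_uIcc_left hmem))
    (fun y hy => hderiv y ⟨hy.1, hy.2.trans hc.2⟩) fun y hy => sign_neg (sub_neg.2 hy.2)
  have hright := tendsto_integral_fresnelKernel_of_sign_eq hc.2.le
    (hφ.mono (Set.Icc_subset_Icc_left hc.1.le))
    (hφ'.mono_set (Set.uIcc_subset_uIcc_right hmem))
    (fun y hy => hderiv y ⟨hc.1.trans hy.1, hy.2⟩) fun y hy => sign_pos (sub_pos.2 hy.1)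
  have hint {u v : ℝ} (hu : u ∈ Set.Icc a b) (hv : v ∈ Set.Icc a b) (ε : ℝ) : IntervalIntegrable
      (fun y => φ y * (ε⁻¹ * exp (I * (((y - c) / ε : ℝ) : ℂ) ^ 2))) volume u v :=
    ((hφ.mono (Set.uIcc_subset_Icc hu hv)).mul (by fun_prop)).intervalIntegrable
  have hc' := Set.Ioo_subset_Icc_self hc
  have hab := hc.1.le.trans hc.2.le
  convert hleft.add hright using 2 with ε
  · exact (intervalIntegral.integral_add_adjacent_intervals (hint ⟨le_rfl, hab⟩ hc' ε)
      (hint hc' ⟨hab, le_rfl⟩ ε)).symm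
  · simp [sign_neg (sub_neg.2 hc.1), sign_pos (sub_pos.2 hc.2)]
    ring

end Concentration

section AbsolutelyContinuous

variable {f : ℝ → ℂ} {T : EReal}

lemma isOpen_timeInterval (T : EReal) : IsOpen (timeInterval T) :=
  isOpen_Ioi.inter (isOpen_Iio.preimage continuous_coe_real_ereal)

lemma ordConnected_timeInterval (T : EReal) : (timeInterval T).OrdConnected :=
  ⟨fun _ hs _ ht _ hu => ⟨hs.1.trans_le hu.1, (EReal.coe_le_coe_iff.2 hu.2).trans_lt ht.2⟩⟩

lemma acOn_of_contDiffOn {E : Type*} [NormedAddCommGroup E] [NormedSpace ℝ E] [CompleteSpace E]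
    {f : ℝ → E} {I : Set ℝ} (hopen : IsOpen I) (hconn : I.OrdConnected)
    (hf : ContDiffOn ℝ 1 f I) : ACOn f I := by
  have hderiv : ContinuousOn (deriv f) I := hf.continuousOn_deriv_of_isOpen hopen le_rfl
  refine ⟨deriv f, hderiv.locallyIntegrableOn hopen.measurableSet, fun x hx y hy => ?_⟩
  have hsub : Set.uIcc x y ⊆ I := hconn.uIcc_subset hx hy
  refine (intervalIntegral.integral_deriv_eq_sub (fun s hs => ?_)
    (hderiv.mono hsub).intervalIntegrable).symm
  exact (hf.differentiableOn one_ne_zero).differentiableAt (hopen.mem_nhds (hsub hs))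

lemma acDot_of_contDiffOn (hf : ContDiffOn ℝ 1 f {0}ᶜ) : ACDot f :=
  ⟨acOn_of_contDiffOn isOpen_Iio Set.ordConnected_Iio (hf.mono fun _ hx => ne_of_lt hx),
    acOn_of_contDiffOn isOpen_Ioi Set.ordConnected_Ioi (hf.mono fun _ hx => ne_of_gt hx)⟩

lemma ac12_of_contDiffOn {Ψ : ℝ → ℝ → ℂ}
    (htime : ∀ x ≠ 0, ContDiffOn ℝ 1 (fun t => Ψ t x) (timeInterval T))
    (hspace : ∀ t ∈ timeInterval T, ContDiffOn ℝ 2 (Ψ t) {0}ᶜ) : AC12 T Ψ where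
  time x hx := acOn_of_contDiffOn (isOpen_timeInterval T) (ordConnected_timeInterval T) (htime x hx)
  space t ht := acDot_of_contDiffOn ((hspace t ht).of_le one_le_two)
  differentiable t ht _ hx := ((hspace t ht).differentiableOn two_ne_zero).differentiableAt
    (isOpen_compl_singleton.mem_nhds hx)
  space_deriv t ht := acDot_of_contDiffOn
    ((hspace t ht).deriv_of_isOpen isOpen_compl_singleton one_add_one_eq_two.le)

end AbsolutelyContinuous

lemma re_pos_and_im_nonneg_of_arg_mem {α : ℝ} (hα : α < π / 2) {z : ℂ} (hz : z ≠ 0)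
    (harg : arg z ∈ Set.Icc 0 α) : 0 < z.re ∧ 0 ≤ z.im := by
  refine ⟨?_, arg_nonneg_iff.1 harg.1⟩
  refine (abs_arg_lt_pi_div_two_iff.1 ?_).resolve_right hz
  rw [abs_of_nonneg harg.1]
  exact harg.2.trans_lt hα

lemma re_pos_or_re_neg_of_mem_doubleSector {α : ℝ} (hα : α < π / 2) {z : ℂ}
    (hz : z ∈ doubleSector α) : (0 < z.re ∧ 0 ≤ z.im) ∨ (z.re < 0 ∧ z.im ≤ 0) := by
  obtain ⟨hne, harg | harg⟩ := hz
  · exact Or.inl (re_pos_and_im_nonneg_of_arg_mem hα hne harg)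
  · simpa using Or.inr (re_pos_and_im_nonneg_of_arg_mem hα (neg_ne_zero.2 hne) harg)

lemma re_ne_zero_of_mem_doubleSector {α : ℝ} (hα : α < π / 2) {z : ℂ}
    (hz : z ∈ doubleSector α) : z.re ≠ 0 :=
  (re_pos_or_re_neg_of_mem_doubleSector hα hz).elim (fun h => h.1.ne') fun h => h.1.ne

/-- The modulated Bessel function on the right half plane, extended by zero. Cutting off in the
variable `w = xz/(2t)` realizes the step function `Θ(xy)`. -/
def cutBessel (ν : ℝ) (w : ℂ) : ℂ := if 0 < w.re then modBessel ν w else 0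

section CutBessel

variable {ν : ℝ} {w : ℂ}

lemma cutBessel_of_re_pos (hw : 0 < w.re) : cutBessel ν w = modBessel ν w := if_pos hw

lemma cutBessel_of_re_nonpos (hw : w.re ≤ 0) : cutBessel ν w = 0 := if_neg hw.not_gt

lemma cutBessel_eventuallyEq_modBessel (hw : 0 < w.re) : cutBessel ν =ᶠ[𝓝 w] modBessel ν :=
  (continuous_re.continuousAt.eventually_const_lt hw).mono fun _ => cutBessel_of_re_pos

lemma cutBessel_eventuallyEq_zero (hw : w.re < 0) : cutBessel ν =ᶠ[𝓝 w] fun _ => 0 :=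
  (continuous_re.continuousAt.eventually_lt_const hw).mono fun _ h => cutBessel_of_re_nonpos h.le

lemma deriv_cutBessel_of_re_pos (hw : 0 < w.re) : deriv (cutBessel ν) w = deriv (modBessel ν) w :=
  (cutBessel_eventuallyEq_modBessel hw).deriv_eq

lemma deriv_cutBessel_of_re_neg (hw : w.re < 0) : deriv (cutBessel ν) w = 0 := by
  rw [(cutBessel_eventuallyEq_zero hw).deriv_eq, deriv_const]

lemma differentiableAt_cutBessel (hν : 1 / 2 ≤ ν) (hw : w.re ≠ 0) :
    DifferentiableAt ℂ (cutBessel ν) w := by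
  rcases hw.lt_or_gt with h | h
  · exact (differentiableAt_const 0).congr_of_eventuallyEq (cutBessel_eventuallyEq_zero h)
  · exact (differentiableAt_modBessel hν (Or.inl h)).congr_of_eventuallyEq
      (cutBessel_eventuallyEq_modBessel h)

lemma hasDerivAt_deriv_cutBessel (hν : 1 / 2 ≤ ν) (hw : w.re ≠ 0) :
    HasDerivAt (deriv (cutBessel ν))
      (2 * I * deriv (cutBessel ν) w + ((ν ^ 2 - 1 / 4 : ℝ) : ℂ) / w ^ 2 * cutBessel ν w) w := by
  rcases hw.lt_or_gt with h | h
  · rw [deriv_cutBessel_of_re_neg h, cutBessel_of_re_nonpos h.le, mul_zero, mul_zero, add_zero]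
    refine (hasDerivAt_const w 0).congr_of_eventuallyEq ?_
    simpa using (cutBessel_eventuallyEq_zero h).deriv
  · rw [deriv_cutBessel_of_re_pos h, cutBessel_of_re_pos h]
    exact (hasDerivAt_deriv_modBessel hν (Or.inl h)).congr_of_eventuallyEq
      (cutBessel_eventuallyEq_modBessel h).deriv

lemma contDiffAt_cutBessel (hν : 1 / 2 ≤ ν) (hw : w.re ≠ 0) {n : WithTop ℕ∞} :
    ContDiffAt ℝ n (cutBessel ν) w := by
  have hopen : IsOpen {w : ℂ | w.re ≠ 0} := isOpen_ne_fun continuous_re continuous_const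
  have hdiff : DifferentiableOn ℂ (cutBessel ν) {w | w.re ≠ 0} :=
    fun w hw => (differentiableAt_cutBessel hν hw).differentiableWithinAt
  exact ((hdiff.contDiffOn hopen).contDiffAt (hopen.mem_nhds hw)).restrict_scalars ℝ

lemma norm_cutBessel_le {C : ℝ} (hC : ∀ w ∈ quadrant, ‖modBessel ν w‖ ≤ C ∧
    ‖deriv (modBessel ν) w‖ ≤ C) (hw : (0 < w.re ∧ 0 ≤ w.im) ∨ w.re < 0) :
    ‖cutBessel ν w‖ ≤ C ∧ ‖deriv (cutBessel ν) w‖ ≤ C := by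
  rcases hw with ⟨hre, him⟩ | hre
  · rw [cutBessel_of_re_pos hre, deriv_cutBessel_of_re_pos hre]
    exact hC w ⟨hre.le, him, slitPlane_ne_zero (Or.inl hre)⟩
  · have hC_nonneg : 0 ≤ C := (norm_nonneg _).trans (hC I I_mem_quadrant).1
    rw [cutBessel_of_re_nonpos hre.le, deriv_cutBessel_of_re_neg hre, norm_zero]
    exact ⟨hC_nonneg, hC_nonneg⟩

lemma tendsto_cutBessel_zero (hν : 1 / 2 < ν) :
    Tendsto (cutBessel ν) (𝓝[{w | w.re ≠ 0}] 0) (𝓝 0) ∧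
      Tendsto (deriv (cutBessel ν)) (𝓝[{w | w.re ≠ 0}] 0) (𝓝 0) := by
  obtain ⟨C, hC, hbound⟩ := exists_norm_modBessel_le_rpow hν.le
  have hmajorant : Tendsto (fun w : ℂ => C * ‖w‖ ^ (ν - 1 / 2)) (𝓝[{w | w.re ≠ 0}] 0) (𝓝 0) := by
    have hcont : Continuous fun w : ℂ => C * ‖w‖ ^ (ν - 1 / 2) :=
      continuous_const.mul (continuous_norm.rpow_const fun _ => Or.inr (by linarith))
    refine (hcont.tendsto' 0 0 ?_).mono_left nhdsWithin_le_nhds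
    rw [norm_zero, Real.zero_rpow (by linarith), mul_zero]
  have hsmall : ∀ᶠ w : ℂ in 𝓝[{w | w.re ≠ 0}] 0, ‖cutBessel ν w‖ ≤ C * ‖w‖ ^ (ν - 1 / 2) ∧
      ‖deriv (cutBessel ν) w‖ ≤ C * ‖w‖ ^ (ν - 1 / 2) := by
    filter_upwards [self_mem_nhdsWithin,
      nhdsWithin_le_nhds (Metric.closedBall_mem_nhds 0 one_pos)] with w hw hball
    rcases hw.lt_or_gt with h | h
    · rw [cutBessel_of_re_nonpos h.le, deriv_cutBessel_of_re_neg h, norm_zero, and_self]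
      positivity
    · rw [cutBessel_of_re_pos h, deriv_cutBessel_of_re_pos h]
      exact hbound w (Or.inl h) (mem_closedBall_zero_iff.1 hball)
  exact ⟨squeeze_zero_norm' (hsmall.mono fun _ h => h.1) hmajorant,
    squeeze_zero_norm' (hsmall.mono fun _ h => h.2) hmajorant⟩

end CutBessel

/-- The argument `xz/(2t)` of the Bessel function. -/
def besselArg (t x : ℝ) (z : ℂ) : ℂ := x * z / (2 * t)

section BesselArg

variable {t x : ℝ} {z : ℂ}

lemma besselArg_eq_ofReal_mul (t x : ℝ) (z : ℂ) :
    besselArg t x z = ((x / (2 * t) : ℝ) : ℂ) * z := by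
  rw [besselArg]
  push_cast
  ring

lemma re_besselArg_ne_zero (ht : 0 < t) (hx : x ≠ 0) (hz : z.re ≠ 0) :
    (besselArg t x z).re ≠ 0 := by
  rw [besselArg_eq_ofReal_mul, re_ofReal_mul]
  positivity

lemma besselArg_of_mem_doubleSector {α : ℝ} (hα : α < π / 2) (ht : 0 < t) (hx : x ≠ 0)
    (hz : z ∈ doubleSector α) :
    (0 < (besselArg t x z).re ∧ 0 ≤ (besselArg t x z).im) ∨ (besselArg t x z).re < 0 := by
  rw [besselArg_eq_ofReal_mul, re_ofReal_mul, im_ofReal_mul]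
  rcases hx.lt_or_gt with hx | hx <;>
    rcases re_pos_or_re_neg_of_mem_doubleSector hα hz with ⟨hre, him⟩ | ⟨hre, him⟩
  · exact Or.inr (mul_neg_of_neg_of_pos (div_neg_of_neg_of_pos hx (by positivity)) hre)
  · have hneg : x / (2 * t) < 0 := div_neg_of_neg_of_pos hx (by positivity)
    exact Or.inl ⟨mul_pos_of_neg_of_neg hneg hre, mul_nonneg_of_nonpos_of_nonpos hneg.le him⟩
  · exact Or.inl ⟨by positivity, by positivity⟩
  · exact Or.inr (mul_neg_of_pos_of_neg (by positivity) hre)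

lemma hasDerivAt_besselArg_x (t x : ℝ) (z : ℂ) :
    HasDerivAt (fun x => besselArg t x z) (z / (2 * t)) x := by
  simpa [besselArg] using ((hasDerivAt_id x).ofReal_comp.mul_const z).div_const (2 * (t : ℂ))

lemma hasDerivAt_besselArg_t (ht : t ≠ 0) (x : ℝ) (z : ℂ) :
    HasDerivAt (fun t => besselArg t x z) (-(x * z) / (2 * t ^ 2)) t := by
  have hinv := ((hasDerivAt_inv ht).ofReal_comp.const_mul (x * z / 2))
  refine (hinv.congr_deriv ?_).congr_of_eventuallyEq (.of_forall fun u => ?_)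
  · push_cast
    ring
  · simp only [besselArg]
    push_cast
    ring

lemma contDiffAt_besselArg_t (ht : t ≠ 0) (x : ℝ) (z : ℂ) {n : WithTop ℕ∞} :
    ContDiffAt ℝ n (fun t => besselArg t x z) t := by
  refine (contDiffAt_const (c := (x * z))).mul (ContDiffAt.inv ?_ ?_)
  · exact contDiffAt_const.mul ofRealCLM.contDiff.contDiffAt
  · exact mul_ne_zero two_ne_zero (ofReal_ne_zero.2 ht)

end BesselArg

/-- The prefactor `1 / (√(2t) i^{ν + 1})` of the kernel. -/
def prefactor (ν t : ℝ) : ℂ := ((√(2 * t) : ℝ) * I ^ ((ν : ℂ) + 1))⁻¹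

/-- The factor of the continued kernel that remains after splitting off `e^{i(z-x)²/(4t)}`. -/
def kernelFactor (ν t x : ℝ) (z : ℂ) : ℂ := prefactor ν t * cutBessel ν (besselArg t x z)

/-- The Gaussian phase `e^{i(z-x)²/(4t)}`. -/
def gaussianPhase (t x : ℝ) (z : ℂ) : ℂ := exp (I * ((4 * t)⁻¹ : ℝ) * (z - x) ^ 2)

/-- The continuation of the Bessel kernel in its last variable. -/
def kernelCont (ν t x : ℝ) (z : ℂ) : ℂ := gaussianPhase t x z * kernelFactor ν t x z

section Prefactor

variable {t : ℝ}

lemma norm_I_cpow_ofReal_add_one (ν : ℝ) : ‖I ^ ((ν : ℂ) + 1)‖ = 1 := by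
  rw [← ofReal_one, ← ofReal_add, norm_cpow_real, norm_I, Real.one_rpow]

lemma norm_prefactor (ν t : ℝ) : ‖prefactor ν t‖ = (√(2 * t))⁻¹ := by
  rw [prefactor, norm_inv, norm_mul, norm_I_cpow_ofReal_add_one, mul_one, norm_real,
    Real.norm_of_nonneg (Real.sqrt_nonneg _)]

lemma hasDerivAt_prefactor (ν : ℝ) (ht : 0 < t) :
    HasDerivAt (prefactor ν) (prefactor ν t * (-1 / (2 * t))) t := by
  have hsqrt : HasDerivAt (fun t => (√(2 * t))⁻¹) ((√(2 * t))⁻¹ * (-1 / (2 * t))) t := by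
    have hlin : HasDerivAt (fun t : ℝ => 2 * t) 2 t := by
      simpa using (hasDerivAt_id t).const_mul (2 : ℝ)
    have hpos : 0 < √(2 * t) := Real.sqrt_pos.2 (by positivity)
    refine ((hlin.sqrt (by positivity)).inv hpos.ne').congr_deriv ?_
    rw [Real.sq_sqrt (by positivity)]
    field_simp
  refine ((hsqrt.ofReal_comp.mul_const (I ^ ((ν : ℂ) + 1))⁻¹).congr_deriv ?_).congr_of_eventuallyEq
    (.of_forall fun u => ?_)
  · rw [prefactor, mul_inv]
    push_cast
    ring
  · simp only [prefactor, mul_inv, ofReal_inv]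

lemma contDiffAt_prefactor (ν : ℝ) (ht : 0 < t) {n : WithTop ℕ∞} :
    ContDiffAt ℝ n (prefactor ν) t := by
  have hsqrt : ContDiffAt ℝ n (fun t => √(2 * t)) t :=
    (contDiffAt_const.mul contDiffAt_id).sqrt (by positivity)
  refine ((ofRealCLM.contDiff.contDiffAt.comp t hsqrt).mul contDiffAt_const).inv ?_
  have hpos : 0 < √(2 * t) := Real.sqrt_pos.2 (by positivity)
  exact mul_ne_zero (ofReal_ne_zero.2 hpos.ne')
    (norm_ne_zero_iff.1 ((norm_I_cpow_ofReal_add_one ν).trans_ne one_ne_zero))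

end Prefactor

section KernelFactor

variable {ν t x : ℝ} {z : ℂ}

lemma hasDerivAt_kernelFactor_x (hν : 1 / 2 ≤ ν) (ht : 0 < t) (hx : x ≠ 0) (hz : z.re ≠ 0) :
    HasDerivAt (fun x => kernelFactor ν t x z)
      (prefactor ν t * (z / (2 * t) * deriv (cutBessel ν) (besselArg t x z))) x := by
  have hbessel := (differentiableAt_cutBessel hν (re_besselArg_ne_zero ht hx hz)).hasDerivAt.comp x
    (hasDerivAt_besselArg_x t x z)
  exact (hbessel.const_mul _).congr_deriv (by ring)

lemma hasDerivAt_deriv_kernelFactor (hν : 1 / 2 ≤ ν) (ht : 0 < t) (hx : x ≠ 0)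
    (hz : z.re ≠ 0) :
    HasDerivAt (deriv fun x => kernelFactor ν t x z)
      (prefactor ν t * ((z / (2 * t)) ^ 2 * (2 * I) * deriv (cutBessel ν) (besselArg t x z) +
        ((ν ^ 2 - 1 / 4 : ℝ) : ℂ) / x ^ 2 * cutBessel ν (besselArg t x z))) x := by
  have hfirst : (deriv fun x => kernelFactor ν t x z) =ᶠ[𝓝 x] fun x =>
      prefactor ν t * (z / (2 * t) * deriv (cutBessel ν) (besselArg t x z)) :=
    (isOpen_ne.eventually_mem hx).mono fun _ hu => (hasDerivAt_kernelFactor_x hν ht hu hz).deriv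
  have hsecond := (hasDerivAt_deriv_cutBessel hν (re_besselArg_ne_zero ht hx hz)).comp x
    (hasDerivAt_besselArg_x t x z)
  refine ((hsecond.const_mul (z / (2 * t))).const_mul _).congr_of_eventuallyEq hfirst
    |>.congr_deriv ?_
  have hpotential : ((ν ^ 2 - 1 / 4 : ℝ) : ℂ) / besselArg t x z ^ 2 * (z / (2 * t)) ^ 2 =
      ((ν ^ 2 - 1 / 4 : ℝ) : ℂ) / x ^ 2 := by
    have : (x : ℂ) ≠ 0 := ofReal_ne_zero.2 hx
    have : (t : ℂ) ≠ 0 := ofReal_ne_zero.2 ht.ne'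
    have : z ≠ 0 := fun h => hz (by rw [h, zero_re])
    rw [besselArg]
    generalize ((ν ^ 2 - 1 / 4 : ℝ) : ℂ) = l
    field_simp
  rw [← hpotential]
  ring

lemma hasDerivAt_kernelFactor_t (hν : 1 / 2 ≤ ν) (ht : 0 < t) (hx : x ≠ 0) (hz : z.re ≠ 0) :
    HasDerivAt (fun t => kernelFactor ν t x z)
      (prefactor ν t * (-1 / (2 * t) * cutBessel ν (besselArg t x z) +
        -(x * z) / (2 * t ^ 2) * deriv (cutBessel ν) (besselArg t x z))) t := by
  have hbessel := (differentiableAt_cutBessel hν (re_besselArg_ne_zero ht hx hz)).hasDerivAt.comp t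
    (hasDerivAt_besselArg_t ht.ne' x z)
  refine ((hasDerivAt_prefactor ν ht).mul hbessel).congr_deriv ?_
  simp only [Function.comp_apply]
  ring

lemma contDiffAt_kernelFactor_x (hν : 1 / 2 ≤ ν) (ht : 0 < t) (hx : x ≠ 0) (hz : z.re ≠ 0)
    {n : WithTop ℕ∞} : ContDiffAt ℝ n (fun x => kernelFactor ν t x z) x := by
  refine contDiffAt_const.mul
    ((contDiffAt_cutBessel hν (re_besselArg_ne_zero ht hx hz)).fun_comp x ?_)
  exact (ofRealCLM.contDiff.contDiffAt.mul contDiffAt_const).div_const _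

lemma contDiffAt_kernelFactor_t (hν : 1 / 2 ≤ ν) (ht : 0 < t) (hx : x ≠ 0) (hz : z.re ≠ 0)
    {n : WithTop ℕ∞} : ContDiffAt ℝ n (fun t => kernelFactor ν t x z) t :=
  (contDiffAt_prefactor ν ht).mul
    ((contDiffAt_cutBessel hν (re_besselArg_ne_zero ht hx hz)).comp t
      (contDiffAt_besselArg_t ht.ne' x z))

end KernelFactor

section GaussianPhase

variable {f : ℝ → ℂ} {f' : ℂ} {t x : ℝ}

lemma hasDerivAt_gaussianPhase_x (t x : ℝ) (z : ℂ) :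
    HasDerivAt (fun x => gaussianPhase t x z)
      (gaussianPhase t x z * -(I * (z - x) / (2 * t))) x := by
  have hx : HasDerivAt (fun x : ℝ => z - x) (-1) x := by
    simpa using (hasDerivAt_id x).ofReal_comp.const_sub z
  refine ((hx.fun_pow 2).const_mul (I * ((4 * t)⁻¹ : ℝ))).cexp.congr_deriv ?_
  rw [gaussianPhase]
  push_cast
  ring

lemma hasDerivAt_gaussianPhase_t (ht : t ≠ 0) (x : ℝ) (z : ℂ) :
    HasDerivAt (fun t => gaussianPhase t x z)
      (gaussianPhase t x z * -(I * (z - x) ^ 2 / (4 * t ^ 2))) t := by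
  have hinv : HasDerivAt (fun t : ℝ => (4 * t)⁻¹) (-1 / (4 * t ^ 2)) t := by
    have hlin : HasDerivAt (fun t : ℝ => 4 * t) 4 t := by
      simpa using (hasDerivAt_id t).const_mul (4 : ℝ)
    refine (hlin.inv (by positivity)).congr_deriv ?_
    field_simp
  refine ((hinv.ofReal_comp.const_mul I).mul_const ((z - x) ^ 2)).cexp.congr_deriv ?_
  rw [gaussianPhase]
  push_cast
  ring

lemma hasDerivAt_gaussianPhase_mul_x (z : ℂ) (hf : HasDerivAt f f' x) :
    HasDerivAt (fun x => gaussianPhase t x z * f x)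
      (gaussianPhase t x z * (f' - I * (z - x) / (2 * t) * f x)) x :=
  ((hasDerivAt_gaussianPhase_x t x z).mul hf).congr_deriv (by ring)

lemma hasDerivAt_gaussianPhase_mul_t (ht : t ≠ 0) (x : ℝ) (z : ℂ) (hf : HasDerivAt f f' t) :
    HasDerivAt (fun t => gaussianPhase t x z * f t)
      (gaussianPhase t x z * (f' - I * (z - x) ^ 2 / (4 * t ^ 2) * f t)) t :=
  ((hasDerivAt_gaussianPhase_t ht x z).mul hf).congr_deriv (by ring)

lemma hasDerivAt_deriv_gaussianPhase_mul (z : ℂ) (hf : ∀ᶠ u in 𝓝 x, DifferentiableAt ℝ f u)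
    (hf' : HasDerivAt (deriv f) f' x) :
    HasDerivAt (deriv fun x => gaussianPhase t x z * f x)
      (gaussianPhase t x z * (f' - I * (z - x) / t * deriv f x +
        (I / (2 * t) - (z - x) ^ 2 / (4 * t ^ 2)) * f x)) x := by
  have hfirst : (deriv fun x => gaussianPhase t x z * f x) =ᶠ[𝓝 x] fun x =>
      gaussianPhase t x z * (deriv f x - I * (z - x) / (2 * t) * f x) :=
    hf.mono fun _ hu => (hasDerivAt_gaussianPhase_mul_x z hu.hasDerivAt).deriv
  have hlin : HasDerivAt (fun x : ℝ => I * (z - x) / (2 * t)) (-I / (2 * t)) x := by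
    simpa using (((hasDerivAt_id x).ofReal_comp.const_sub z).const_mul I).div_const (2 * (t : ℂ))
  refine (hasDerivAt_gaussianPhase_mul_x z (hf'.sub
    (hlin.mul hf.self_of_nhds.hasDerivAt))).congr_of_eventuallyEq hfirst |>.congr_deriv ?_
  simp only [Pi.sub_apply, Pi.mul_apply]
  linear_combination (gaussianPhase t x z * ((z - x) ^ 2 / (4 * t ^ 2)) * f x) * I_sq

lemma contDiff_gaussianPhase_x (t : ℝ) (z : ℂ) {n : WithTop ℕ∞} :
    ContDiff ℝ n fun x => gaussianPhase t x z :=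
  (contDiff_const.mul ((contDiff_const.sub ofRealCLM.contDiff).pow 2)).cexp

lemma contDiffAt_gaussianPhase_t (ht : t ≠ 0) (x : ℝ) (z : ℂ) {n : WithTop ℕ∞} :
    ContDiffAt ℝ n (fun t => gaussianPhase t x z) t := by
  have hinv : ContDiffAt ℝ n (fun t : ℝ => (4 * t)⁻¹) t :=
    (contDiffAt_const.mul contDiffAt_id).inv (by simpa using ht)
  exact ((contDiffAt_const.mul (ofRealCLM.contDiff.contDiffAt.comp t hinv)).mul
    contDiffAt_const).cexp

end GaussianPhase

section KernelCont

variable {ν : ℝ} {T : EReal} {z : ℂ}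

lemma differentiableAt_kernelCont (hν : 1 / 2 ≤ ν) {t x : ℝ} (ht : 0 < t) (hx : x ≠ 0)
    (hz : z.re ≠ 0) : DifferentiableAt ℂ (kernelCont ν t x) z := by
  have hphase : DifferentiableAt ℂ (gaussianPhase t x) z := by
    unfold gaussianPhase
    fun_prop
  have harg : DifferentiableAt ℂ (besselArg t x) z := by
    unfold besselArg
    fun_prop
  exact hphase.mul ((DifferentiableAt.comp z
    (differentiableAt_cutBessel hν (re_besselArg_ne_zero ht hx hz)) harg).const_mul _)

lemma ac12_kernelCont (hν : 1 / 2 ≤ ν) (T : EReal) (hz : z.re ≠ 0) :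
    AC12 T (fun t x => kernelCont ν t x z) :=
  ac12_of_contDiffOn
    (fun x hx _ ht => ((contDiffAt_gaussianPhase_t ht.1.ne' x z).mul
      (contDiffAt_kernelFactor_t hν ht.1 hx hz)).contDiffWithinAt)
    (fun t ht _ hx => ((contDiff_gaussianPhase_x t z).contDiffAt.mul
      (contDiffAt_kernelFactor_x hν ht.1 hx hz)).contDiffWithinAt)

lemma solvesSchrodinger_kernelCont (hν : 1 / 2 ≤ ν) (T : EReal) (hz : z.re ≠ 0) :
    SolvesSchrodinger T (fun _ x => (((ν ^ 2 - 1 / 4) / x ^ 2 : ℝ) : ℂ))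
      (fun t x => kernelCont ν t x z) := by
  refine .of_forall fun ⟨t, x⟩ ⟨ht, _⟩ hx => ?_
  have hdiff : ∀ᶠ u in 𝓝 x, DifferentiableAt ℝ (fun x => kernelFactor ν t x z) u :=
    (isOpen_ne.eventually_mem hx).mono fun _ hu =>
      (hasDerivAt_kernelFactor_x hν ht hu hz).differentiableAt
  refine ⟨_, _, hasDerivAt_gaussianPhase_mul_t ht.ne' x z (hasDerivAt_kernelFactor_t hν ht hx hz),
    hasDerivAt_deriv_gaussianPhase_mul z hdiff (hasDerivAt_deriv_kernelFactor hν ht hx hz), ?_⟩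
  have : (x : ℂ) ≠ 0 := ofReal_ne_zero.2 hx
  have : (t : ℂ) ≠ 0 := ofReal_ne_zero.2 ht.ne'
  rw [(hasDerivAt_kernelFactor_x hν ht hx hz).deriv]
  simp only [kernelCont, kernelFactor]
  push_cast
  field_simp
  ring_nf
  rw [I_sq]
  ring

lemma modBessel_ofReal {r : ℝ} (hr : 0 < r) (ν : ℝ) :
    modBessel ν r = exp (I * r) * (√r : ℝ) * besselJ ν r := by
  have hsqrt : ((√r : ℝ) : ℂ) = (r : ℂ) ^ (1 / 2 : ℂ) := by
    rw [Real.sqrt_eq_rpow, ofReal_cpow hr.le]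
    push_cast
    rfl
  have hpow : ((r : ℂ) / 2) ^ (ν : ℂ) = (r : ℂ) ^ (ν : ℂ) * 2 ^ (-ν : ℂ) := by
    rw [← ofReal_ofNat, ← ofReal_div, div_eq_mul_inv, ofReal_mul,
      mul_cpow_ofReal_nonneg hr.le (by norm_num), ofReal_inv, cpow_neg, inv_cpow]
    simp [Real.pi_pos.ne]
  have hbessel : besselJ ν r = ((r : ℂ) / 2) ^ (ν : ℂ) * besselEntire ν r := rfl
  have hr0 : (r : ℂ) ≠ 0 := ofReal_ne_zero.2 hr.ne'
  rw [hbessel, hpow, hsqrt, modBessel, modBesselFactor]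
  push_cast
  rw [cpow_add _ _ hr0]
  ring

lemma besselKernel_eq_kernelCont {t : ℝ} (ht : 0 < t) (ν x y : ℝ) :
    besselKernel ν t x y = kernelCont ν t x y := by
  have harg : besselArg t x y = ((x * y / (2 * t) : ℝ) : ℂ) := by
    rw [besselArg]
    push_cast
    rfl
  rw [kernelCont, kernelFactor, harg, besselKernel]
  rcases lt_or_ge 0 (x * y) with hpos | hnonpos
  · have hr : 0 < x * y / (2 * t) := by positivity
    have hsqrt : ((√(x * y) : ℝ) : ℂ) / (2 * t) =
        ((√(2 * t) : ℝ) : ℂ)⁻¹ * (√(x * y / (2 * t)) : ℝ) := by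
      rw [Real.sqrt_div hpos.le]
      norm_cast
      rw [← div_eq_inv_mul, div_div, Real.mul_self_sqrt (by positivity)]
    have hphase : exp (-((x : ℂ) ^ 2 + (y : ℂ) ^ 2) / (4 * I * t)) =
        gaussianPhase t x y * exp (I * (x * y / (2 * t) : ℝ)) := by
      have : (t : ℂ) ≠ 0 := ofReal_ne_zero.2 ht.ne'
      rw [gaussianPhase, ← exp_add]
      congr 1
      push_cast
      field_simp
      linear_combination (-2 * ((x : ℂ) ^ 2 + (y : ℂ) ^ 2)) * I_sq
    rw [cutBessel_of_re_pos (by rwa [ofReal_re]), modBessel_ofReal hr, heaviside, if_pos hpos,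
      one_mul, hphase, prefactor, mul_right_comm (2 : ℂ), ← div_div, hsqrt, mul_inv]
    push_cast
    ring
  · have hre : x * y / (2 * t) ≤ 0 := div_nonpos_of_nonpos_of_nonneg hnonpos (by positivity)
    rw [cutBessel_of_re_nonpos (by rwa [ofReal_re]), heaviside, if_neg hnonpos.not_gt]
    simp

lemma tendsto_kernelCont_zero (hν : 1 / 2 < ν) {t : ℝ} (ht : 0 < t) (hz : z.re ≠ 0) :
    Tendsto (fun x => kernelCont ν t x z) (𝓝[≠] 0) (𝓝 0) ∧
      Tendsto (deriv fun x => kernelCont ν t x z) (𝓝[≠] 0) (𝓝 0) := by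
  have harg : Tendsto (fun x => besselArg t x z) (𝓝[≠] 0) (𝓝[{w | w.re ≠ 0}] 0) := by
    have hcont : Continuous fun x => besselArg t x z := by
      unfold besselArg
      fun_prop
    refine tendsto_nhdsWithin_iff.2 ⟨(hcont.tendsto' 0 0 ?_).mono_left nhdsWithin_le_nhds, ?_⟩
    · simp [besselArg]
    · exact eventually_mem_nhdsWithin.mono fun x hx => re_besselArg_ne_zero ht hx hz
  have hphase : Tendsto (fun x => gaussianPhase t x z) (𝓝[≠] 0) (𝓝 (gaussianPhase t 0 z)) :=
    ((contDiff_gaussianPhase_x t z (n := 0)).continuous.tendsto 0).mono_left nhdsWithin_le_nhds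
  have hfactor : Tendsto (fun x => kernelFactor ν t x z) (𝓝[≠] 0) (𝓝 0) := by
    simpa [kernelFactor] using ((tendsto_cutBessel_zero hν).1.comp harg).const_mul (prefactor ν t)
  have hfactor' : Tendsto (fun x => prefactor ν t *
      (z / (2 * t) * deriv (cutBessel ν) (besselArg t x z))) (𝓝[≠] 0) (𝓝 0) := by
    simpa using (((tendsto_cutBessel_zero hν).2.comp harg).const_mul (z / (2 * t))).const_mul
      (prefactor ν t)
  have hlin : Tendsto (fun x : ℝ => I * (z - x) / (2 * t)) (𝓝[≠] 0) (𝓝 (I * z / (2 * t))) := by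
    have hcont : Continuous fun x : ℝ => I * (z - x) / (2 * (t : ℂ)) := by fun_prop
    exact (hcont.tendsto' 0 _ (by simp)).mono_left nhdsWithin_le_nhds
  constructor
  · simpa [kernelCont] using hphase.mul hfactor
  · have hlimit := hphase.mul (hfactor'.sub (hlin.mul hfactor))
    rw [mul_zero, sub_zero, mul_zero] at hlimit
    refine hlimit.congr' (eventually_mem_nhdsWithin.mono fun x hx => ?_)
    exact (hasDerivAt_gaussianPhase_mul_x z
      (hasDerivAt_kernelFactor_x hν.le ht hx hz)).deriv.symm

lemma transmissionCondition_besselKernel (hν : 1 / 2 < ν) {t y : ℝ} (ht : 0 < t) (hy : y ≠ 0) :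
    TransmissionCondition 1 0 (fun x => besselKernel ν t x y) := by
  rw [funext fun x => besselKernel_eq_kernelCont ht ν x y]
  obtain ⟨hvalue, hderiv⟩ := tendsto_kernelCont_zero hν ht (z := y) (by simpa using hy)
  have hright : 𝓝[>] (0 : ℝ) ≤ 𝓝[≠] 0 := nhdsGT_le_nhdsNE 0
  have hleft : 𝓝[<] (0 : ℝ) ≤ 𝓝[≠] 0 := nhdsLT_le_nhdsNE 0
  exact ⟨0, 0, 0, 0, hvalue.mono_left hright, hvalue.mono_left hleft, hderiv.mono_left hright,
    hderiv.mono_left hleft, by simp⟩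

end KernelCont

section ExponentialBounds

variable {ν C lam t x : ℝ} {z H H' : ℂ}

/-- The coefficients `A₀, A₁, A₂` of the exponential bounds of `kernelFactor`; here `lam` is the
coupling constant of the potential and `C` bounds `cutBessel` and its derivative. -/
def boundCoeff (C lam : ℝ) (j : Fin 3) (t x : ℝ) : ℝ :=
  ![(√(2 * t))⁻¹ * C, (√(2 * t))⁻¹ * (C / (2 * t)),
    (√(2 * t))⁻¹ * (C / t ^ 2 + lam / x ^ 2 * C + (C / (2 * t) + |x| / (2 * t ^ 2) * C))] j

lemma boundCoeff_nonneg (hC : 0 ≤ C) (hlam : 0 ≤ lam) (ht : 0 ≤ t) (j : Fin 3) (x : ℝ) :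
    0 ≤ boundCoeff C lam j t x := by
  fin_cases j <;> simp only [boundCoeff, Fin.zero_eta, Fin.mk_one, Fin.reduceFinMk,
    Matrix.cons_val] <;> positivity

lemma isCoefficient_boundCoeff (hC : 0 ≤ C) (hlam : 0 ≤ lam) (T : EReal) (j : Fin 3) :
    IsCoefficient T (boundCoeff C lam j) := by
  refine ⟨fun ⟨t, x⟩ ⟨ht, hx⟩ => ContinuousAt.continuousWithinAt ?_,
    fun t ht x _ => boundCoeff_nonneg hC hlam ht.1.le j x⟩
  have : 0 < t := ht.1
  have : x ≠ 0 := hx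
  fin_cases j <;> simp only [boundCoeff, Fin.zero_eta, Fin.mk_one, Fin.reduceFinMk,
    Matrix.cons_val] <;> fun_prop (disch := positivity)

lemma norm_le_exp_norm (z : ℂ) : ‖z‖ ≤ Real.exp ‖z‖ :=
  (le_add_of_nonneg_right zero_le_one).trans (Real.add_one_le_exp _)

lemma norm_sq_le_two_mul_exp_norm (z : ℂ) : ‖z‖ ^ 2 ≤ 2 * Real.exp ‖z‖ := by
  linarith [Real.quadratic_le_exp_of_nonneg (norm_nonneg z), norm_nonneg z]

lemma norm_kernelFactor_le (hH : ‖H‖ ≤ C) :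
    ‖prefactor ν t * H‖ ≤ boundCoeff C lam 0 t x * Real.exp ‖z‖ := by
  have hC : 0 ≤ C := (norm_nonneg H).trans hH
  rw [norm_mul, norm_prefactor]
  exact (mul_le_mul_of_nonneg_left hH (by positivity)).trans
    (le_mul_of_one_le_right (by positivity) (Real.one_le_exp (norm_nonneg z)))

lemma norm_kernelFactor_x_le (ht : 0 < t) (hH' : ‖H'‖ ≤ C) :
    ‖prefactor ν t * (z / (2 * t) * H')‖ ≤ boundCoeff C lam 1 t x * Real.exp ‖z‖ := by
  have hnorm : ‖prefactor ν t * (z / (2 * t) * H')‖ =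
      (√(2 * t))⁻¹ * (‖z‖ / (2 * t) * ‖H'‖) := by
    simp [norm_prefactor, abs_of_pos ht]
  calc ‖prefactor ν t * (z / (2 * t) * H')‖
      ≤ (√(2 * t))⁻¹ * (Real.exp ‖z‖ / (2 * t) * C) := by
        rw [hnorm]
        gcongr
        exact norm_le_exp_norm z
    _ = boundCoeff C lam 1 t x * Real.exp ‖z‖ := by
        simp only [boundCoeff, Matrix.cons_val]
        ring

lemma norm_kernelFactor_xx_le (ht : 0 < t) (hlam : 0 ≤ lam) (hH : ‖H‖ ≤ C) (hH' : ‖H'‖ ≤ C) :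
    ‖prefactor ν t * ((z / (2 * t)) ^ 2 * (2 * I) * H' + (lam : ℂ) / x ^ 2 * H)‖ ≤
      boundCoeff C lam 2 t x * Real.exp ‖z‖ := by
  have hC : 0 ≤ C := (norm_nonneg H).trans hH
  have hone : 1 ≤ Real.exp ‖z‖ := Real.one_le_exp (norm_nonneg z)
  have hfirst : ‖(z / (2 * t)) ^ 2 * (2 * I) * H'‖ ≤ C / t ^ 2 * Real.exp ‖z‖ := by
    have hnorm : ‖(z / (2 * t)) ^ 2 * (2 * I) * H'‖ = ‖z‖ ^ 2 / (2 * t ^ 2) * ‖H'‖ := by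
      simp only [norm_mul, norm_pow, norm_div, norm_ofNat, norm_real, norm_I, Real.norm_eq_abs,
        abs_of_pos ht]
      field_simp
    calc ‖(z / (2 * t)) ^ 2 * (2 * I) * H'‖ ≤ 2 * Real.exp ‖z‖ / (2 * t ^ 2) * C := by
          rw [hnorm]
          gcongr
          exact norm_sq_le_two_mul_exp_norm z
      _ = C / t ^ 2 * Real.exp ‖z‖ := by ring
  have hsecond : ‖(lam : ℂ) / x ^ 2 * H‖ ≤ lam / x ^ 2 * C * Real.exp ‖z‖ := by
    calc ‖(lam : ℂ) / x ^ 2 * H‖ = lam / x ^ 2 * ‖H‖ := by simp [abs_of_nonneg hlam]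
      _ ≤ lam / x ^ 2 * C := by gcongr
      _ ≤ lam / x ^ 2 * C * Real.exp ‖z‖ := le_mul_of_one_le_right (by positivity) hone
  have hrest : 0 ≤ (C / (2 * t) + |x| / (2 * t ^ 2) * C) * Real.exp ‖z‖ := by positivity
  simp only [boundCoeff, Matrix.cons_val]
  rw [norm_mul, norm_prefactor, mul_assoc (√(2 * t))⁻¹]
  gcongr
  linarith [norm_add_le_of_le hfirst hsecond]

lemma norm_kernelFactor_t_le (ht : 0 < t) (hlam : 0 ≤ lam) (hH : ‖H‖ ≤ C) (hH' : ‖H'‖ ≤ C) :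
    ‖prefactor ν t * (-1 / (2 * t) * H + -(x * z) / (2 * t ^ 2) * H')‖ ≤
      boundCoeff C lam 2 t x * Real.exp ‖z‖ := by
  have hC : 0 ≤ C := (norm_nonneg H).trans hH
  have hone : 1 ≤ Real.exp ‖z‖ := Real.one_le_exp (norm_nonneg z)
  have hfirst : ‖-1 / (2 * (t : ℂ)) * H‖ ≤ C / (2 * t) * Real.exp ‖z‖ := by
    calc ‖-1 / (2 * (t : ℂ)) * H‖ = ‖H‖ / (2 * t) := by
          simp [abs_of_pos ht]
          ring
      _ ≤ C / (2 * t) := by gcongr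
      _ ≤ C / (2 * t) * Real.exp ‖z‖ := le_mul_of_one_le_right (by positivity) hone
  have hsecond : ‖-(x * z) / (2 * t ^ 2) * H'‖ ≤ |x| / (2 * t ^ 2) * C * Real.exp ‖z‖ := by
    calc ‖-(x * z) / (2 * t ^ 2) * H'‖ = |x| * ‖z‖ / (2 * t ^ 2) * ‖H'‖ := by
          simp
      _ ≤ |x| * Real.exp ‖z‖ / (2 * t ^ 2) * C := by
          gcongr
          exact norm_le_exp_norm z
      _ = |x| / (2 * t ^ 2) * C * Real.exp ‖z‖ := by ring
  have hrest : 0 ≤ (C / t ^ 2 + lam / x ^ 2 * C) * Real.exp ‖z‖ := by positivity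
  simp only [boundCoeff, Matrix.cons_val]
  rw [norm_mul, norm_prefactor, mul_assoc (√(2 * t))⁻¹]
  gcongr
  linarith [norm_add_le_of_le hfirst hsecond]

lemma acOn_inv_four_mul (T : EReal) : ACOn (fun t => (4 * t)⁻¹) (timeInterval T) := by
  refine acOn_of_contDiffOn (isOpen_timeInterval T) (ordConnected_timeInterval T) ?_
  exact (contDiff_const.mul contDiff_id).contDiffOn.inv
    fun t ht => mul_ne_zero four_ne_zero ht.1.ne'

lemma tendsto_inv_four_mul_nhdsGT_zero :
    Tendsto (fun t : ℝ => (4 * t)⁻¹) (𝓝[>] 0) atTop := by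
  simp only [mul_inv]
  exact tendsto_inv_nhdsGT_zero.const_mul_atTop (by norm_num)

lemma boundCoeff_zero_div_sqrt (ht : 0 < t) :
    boundCoeff C lam 0 t x / √((4 * t)⁻¹) = √2 * C := by
  have hsqrt : √(4 * t) = √2 * √(2 * t) := by
    rw [← Real.sqrt_mul zero_le_two]
    ring_nf
  simp only [boundCoeff, Matrix.cons_val]
  rw [Real.sqrt_inv, div_inv_eq_mul, hsqrt]
  field_simp

lemma exponentialBounds_kernelCont (hν : 1 / 2 ≤ ν) (T : EReal) {α : ℝ} (hα : α < π / 2)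
    (hC : ∀ w ∈ quadrant, ‖modBessel ν w‖ ≤ C ∧ ‖deriv (modBessel ν) w‖ ≤ C) :
    ExponentialBounds T 1 0 (doubleSector α) (kernelCont ν) (kernelFactor ν)
      (fun t => (4 * t)⁻¹) 1 (boundCoeff C (ν ^ 2 - 1 / 4)) (fun _ _ _ => 1) := by
  have hC0 : 0 ≤ C := (norm_nonneg _).trans (hC I I_mem_quadrant).1
  have hlam : 0 ≤ ν ^ 2 - 1 / 4 := by nlinarith
  have hbound {t x : ℝ} {z : ℂ} (ht : t ∈ timeInterval T) (hx : x ≠ 0) (hz : z ∈ doubleSector α) :=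
    norm_cutBessel_le hC (besselArg_of_mem_doubleSector hα ht.1 hx hz)
  refine
    { ac := acOn_inv_four_mul T
      pos := fun t ht => by have : 0 < t := ht.1; positivity
      tendsto := tendsto_inv_four_mul_nhdsGT_zero
      decomposition := fun t _ x _ z _ => rfl
      p_mem := by norm_num
      coeffA := isCoefficient_boundCoeff hC0 hlam T
      coeffB := fun _ => ⟨continuousOn_const, fun _ _ _ _ => zero_le_one⟩
      bound := fun t ht x hx z hz => ?_
      bound_x := fun t ht x hx z hz => ⟨_, hasDerivAt_kernelFactor_x hν ht.1 hx
        (re_ne_zero_of_mem_doubleSector hα hz), ?_⟩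
      bound_xx := fun t ht x hx z hz => ⟨_, hasDerivAt_deriv_kernelFactor hν ht.1 hx
        (re_ne_zero_of_mem_doubleSector hα hz), ?_⟩
      bound_t := fun t ht x hx z hz => ⟨_, hasDerivAt_kernelFactor_t hν ht.1 hx
        (re_ne_zero_of_mem_doubleSector hα hz), ?_⟩
      bounded_time := fun x _ => ⟨⟨|√2 * C|, eventually_mem_nhdsWithin.mono fun t ht => ?_⟩,
        ⟨1, by simp⟩⟩
      bounded_space := fun _ _ t _ => ⟨⟨|(√(2 * t))⁻¹ * C|, .of_forall fun x => le_rfl⟩,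
        ⟨1, by simp⟩⟩
      bounded_space_deriv := fun h => absurd rfl h }
  all_goals simp only [one_mul, Real.rpow_one]
  · exact norm_kernelFactor_le (hbound ht hx hz).1
  · exact norm_kernelFactor_x_le ht.1 (hbound ht hx hz).2
  · exact norm_kernelFactor_xx_le ht.1 hlam (hbound ht hx hz).1 (hbound ht hx hz).2
  · exact norm_kernelFactor_t_le ht.1 hlam (hbound ht hx hz).1 (hbound ht hx hz).2
  · rw [boundCoeff_zero_div_sqrt ht]

end ExponentialBounds

section InitialCondition

variable {ν : ℝ}

lemma continuous_modBessel_ofReal (hν : 1 / 2 ≤ ν) : Continuous fun r : ℝ => modBessel ν r := by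
  have hpow : Continuous fun r : ℝ => (r : ℂ) ^ ((ν + 1 / 2 : ℝ) : ℂ) :=
    continuous_ofReal_cpow_const (by rw [ofReal_re]; linarith)
  exact hpow.mul ((differentiable_modBesselFactor hν).continuous.comp continuous_ofReal)

lemma exists_norm_modBessel_sub_le_rpow (hν : 1 / 2 ≤ ν) {s : ℝ} (hs : s ∈ Set.Icc 0 1) :
    ∃ (D : ℂ) (C : ℝ), ∀ r : ℝ, 0 < r →
      ‖modBessel ν r - (modBesselLimit ν + D * exp (2 * I * r))‖ ≤ C * r ^ (-s) := by
  obtain ⟨D, C₁, hC₁⟩ := exists_modBessel_asymptotics hν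
  obtain ⟨C₂, hC₂⟩ := exists_norm_modBessel_le hν
  have hC₁_nonneg : 0 ≤ C₁ := by simpa using (norm_nonneg _).trans (hC₁ 1 le_rfl)
  refine ⟨D, max C₁ (C₂ + (‖modBesselLimit ν‖ + ‖D‖)), fun r hr => ?_⟩
  rcases le_total r 1 with hr1 | hr1
  · have hexp : ‖D * exp (2 * I * r)‖ = ‖D‖ := by
      rw [norm_mul, norm_exp_two_I_mul, mul_one]
    refine (le_mul_of_one_le_right (hC₁_nonneg.trans (le_max_left _ _))
      (Real.one_le_rpow_of_pos_of_le_one_of_nonpos hr hr1 (neg_nonpos.2 hs.1))).trans' ?_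
    refine ((norm_sub_le _ _).trans ?_).trans (le_max_right _ _)
    exact add_le_add (hC₂ r (ofReal_mem_quadrant hr)).1
      ((norm_add_le _ _).trans_eq (by rw [hexp]))
  · calc _ ≤ C₁ * r ^ (-1 : ℝ) := by
          rw [Real.rpow_neg_one, ← div_eq_mul_inv]
          exact hC₁ r hr1
      _ ≤ max C₁ (C₂ + (‖modBesselLimit ν‖ + ‖D‖)) * r ^ (-s) := by
          gcongr
          exacts [le_max_left _ _, hs.2]

lemma tendsto_integral_fresnelKernel_mul_of_norm_le_rpow {R φ : ℝ → ℂ} {b C k s : ℝ}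
    (hs : s ∈ Set.Ioo (1 / 2) 1) (hR : ∀ r, 0 < r → ‖R r‖ ≤ C * r ^ (-s)) (hb : 0 ≤ b)
    (hk : 0 < k) (hφ : ContinuousOn φ (Set.Icc 0 b)) (c : ℝ) :
    Tendsto (fun ε : ℝ => ∫ y in (0 : ℝ)..b,
        φ y * (ε⁻¹ * exp (I * (((y - c) / ε : ℝ) : ℂ) ^ 2)) * R (k * y / ε ^ 2))
      (𝓝[>] 0) (𝓝 0) := by
  obtain ⟨m, hm⟩ := isCompact_Icc.exists_bound_of_continuousOn hφ
  have hint : IntervalIntegrable (fun y : ℝ => m * C * k ^ (-s) * y ^ (-s)) volume 0 b :=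
    (intervalIntegral.intervalIntegrable_rpow' (by linarith [hs.2])).const_mul _
  have hpow : Tendsto (fun ε : ℝ => ε ^ (2 * s - 1)) (𝓝[>] 0) (𝓝 0) := by
    have hcont := Real.continuous_rpow_const (q := 2 * s - 1) (by linarith [hs.1])
    exact (hcont.tendsto' 0 0 (Real.zero_rpow (by linarith [hs.1]))).mono_left nhdsWithin_le_nhds
  have hlim := hpow.mul_const (∫ y in (0 : ℝ)..b, m * C * k ^ (-s) * y ^ (-s))
  rw [zero_mul] at hlim
  refine squeeze_zero_norm' (eventually_mem_nhdsWithin.mono fun ε (hε : 0 < ε) => ?_) hlim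
  rw [← intervalIntegral.integral_const_mul]
  refine intervalIntegral.norm_integral_le_of_norm_le hb (.of_forall fun y hy => ?_)
    (hint.const_mul _)
  have hscale : ε⁻¹ * (k * y / ε ^ 2) ^ (-s) = ε ^ (2 * s - 1) * (k ^ (-s) * y ^ (-s)) := by
    have hpow_sq : (ε ^ 2) ^ (-s) = (ε ^ (2 * s))⁻¹ := by
      rw [← Real.rpow_natCast, ← Real.rpow_mul hε.le, ← Real.rpow_neg hε.le]
      push_cast
      ring_nf
    rw [Real.div_rpow (mul_nonneg hk.le hy.1.le) (sq_nonneg ε), Real.mul_rpow hk.le hy.1.le,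
      hpow_sq, Real.rpow_sub_one hε.ne', div_inv_eq_mul]
    ring
  calc ‖φ y * (ε⁻¹ * exp (I * (((y - c) / ε : ℝ) : ℂ) ^ 2)) * R (k * y / ε ^ 2)‖
      = ‖φ y‖ * ε⁻¹ * ‖R (k * y / ε ^ 2)‖ := by
        rw [norm_mul, norm_mul, norm_mul, norm_exp_I_mul_sq, mul_one, norm_real,
          Real.norm_of_nonneg (inv_nonneg.2 hε.le)]
    _ ≤ m * ε⁻¹ * (C * (k * y / ε ^ 2) ^ (-s)) := by
        have : 0 < y := hy.1
        have : 0 ≤ m := (norm_nonneg _).trans (hm 0 ⟨le_rfl, hb⟩)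
        gcongr
        exacts [hm y ⟨hy.1.le, hy.2⟩, hR _ (by positivity)]
    _ = ε ^ (2 * s - 1) * (m * C * k ^ (-s) * y ^ (-s)) := by
        linear_combination m * C * hscale

variable {b x : ℝ} {φ φ' : ℝ → ℂ}

lemma exp_neg_center_eq {ε : ℝ} (hε : ε ≠ 0) (x y : ℝ) :
    exp (I * (((y - -x) / ε : ℝ) : ℂ) ^ 2) =
      exp (I * (((y - x) / ε : ℝ) : ℂ) ^ 2) * exp (2 * I * (2 * x * y / ε ^ 2 : ℝ)) := by
  have : (ε : ℂ) ≠ 0 := ofReal_ne_zero.2 hε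
  rw [← exp_add]
  congr 1
  push_cast
  field_simp
  ring

lemma tendsto_integral_fresnelKernel_mul_modBessel (hν : 1 / 2 ≤ ν) (hx : x ∈ Set.Ioo 0 b)
    (hφ : ContinuousOn φ (Set.Icc 0 b)) (hφ' : IntervalIntegrable φ' volume 0 b)
    (hderiv : ∀ y ∈ Set.Ioo 0 b, HasDerivAt φ (φ' y) y) :
    Tendsto (fun ε : ℝ => ∫ y in (0 : ℝ)..b, φ y *
        (ε⁻¹ * exp (I * (((y - x) / ε : ℝ) : ℂ) ^ 2)) * modBessel ν (2 * x * y / ε ^ 2 : ℝ))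
      (𝓝[>] 0) (𝓝 (modBesselLimit ν * (2 * fresnelLimit * φ x))) := by
  have hb : 0 ≤ b := hx.1.le.trans hx.2.le
  obtain ⟨D, C, hC⟩ := exists_norm_modBessel_sub_le_rpow hν (s := 3 / 4) (by norm_num)
  let R (r : ℝ) : ℂ := modBessel ν r - (modBesselLimit ν + D * exp (2 * I * r))
  have hR_cont : Continuous R := (continuous_modBessel_ofReal hν).sub (by fun_prop)
  have hmain := (tendsto_integral_fresnelKernel_of_mem hφ hφ' hderiv hx).const_mul
    (modBesselLimit ν)
  have hreflected := (tendsto_integral_fresnelKernel_of_lt hb hφ hφ' hderiv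
    (neg_lt_zero.2 hx.1)).const_mul D
  have hremainder := tendsto_integral_fresnelKernel_mul_of_norm_le_rpow (s := 3 / 4)
    (by norm_num) hC hb (mul_pos two_pos hx.1) hφ x
  have hlim := (hmain.add hreflected).add hremainder
  rw [mul_zero, add_zero, add_zero] at hlim
  refine hlim.congr' (eventually_mem_nhdsWithin.mono fun ε (hε : 0 < ε) => ?_)
  have hφ_int : ContinuousOn φ (Set.uIcc 0 b) := by rwa [Set.uIcc_of_le hb]
  have hint (c : ℝ) : IntervalIntegrable
      (fun y => φ y * (ε⁻¹ * exp (I * (((y - c) / ε : ℝ) : ℂ) ^ 2))) volume 0 b :=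
    (hφ_int.mul (by fun_prop)).intervalIntegrable
  have hint_R : IntervalIntegrable (fun y => φ y *
      (ε⁻¹ * exp (I * (((y - x) / ε : ℝ) : ℂ) ^ 2)) * R (2 * x * y / ε ^ 2)) volume 0 b :=
    ((hφ_int.mul (by fun_prop)).mul (by fun_prop)).intervalIntegrable
  rw [← intervalIntegral.integral_const_mul, ← intervalIntegral.integral_const_mul,
    ← intervalIntegral.integral_add ((hint x).const_mul _) ((hint (-x)).const_mul _),
    ← intervalIntegral.integral_add (((hint x).const_mul _).add ((hint (-x)).const_mul _)) hint_R]
  refine intervalIntegral.integral_congr fun y _ => ?_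
  simp only [R, exp_neg_center_eq hε.ne']
  ring

lemma I_cpow_add_one_eq (ν : ℝ) :
    I ^ ((ν : ℂ) + 1) = I ^ ((ν + 1 / 2 : ℝ) : ℂ) * eighthRoot := by
  have hexponent : (ν : ℂ) + 1 = ((ν + 1 / 2 : ℝ) : ℂ) + 1 / 2 := by
    push_cast
    ring
  have hhalf : I ^ (1 / 2 : ℂ) = eighthRoot := by
    rw [cpow_def_of_ne_zero I_ne_zero, log_I, eighthRoot]
    congr 1
    push_cast
    ring
  rw [hexponent, cpow_add _ _ I_ne_zero, hhalf]

lemma two_mul_prefactor_one_mul_limits (ν : ℝ) :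
    2 * prefactor ν 1 * (modBesselLimit ν * (2 * fresnelLimit)) = 1 := by
  have hroot : eighthRoot ≠ 0 := exp_ne_zero _
  have hπ : ((√π : ℝ) : ℂ) ≠ 0 := ofReal_ne_zero.2 (Real.sqrt_pos.2 Real.pi_pos).ne'
  have htwo : ((√2 : ℝ) : ℂ) ^ 2 = 2 := by
    rw [← ofReal_pow, Real.sq_sqrt zero_le_two, ofReal_ofNat]
  rw [prefactor, modBesselLimit, fresnelLimit, I_cpow_add_one_eq, mul_one,
    Real.sqrt_mul zero_le_two]
  push_cast
  field_simp
  exact htwo.symm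

lemma besselKernel_of_nonpos {y : ℝ} (hxy : x * y ≤ 0) (ν t : ℝ) : besselKernel ν t x y = 0 := by
  simp [besselKernel, heaviside, hxy.not_gt]

lemma besselKernel_sq_div_four {ε y : ℝ} (hε : 0 < ε) (hx : 0 < x) (hy : 0 < y) (ν : ℝ) :
    besselKernel ν (ε ^ 2 / 4) x y = 2 * prefactor ν 1 *
      ((ε⁻¹ * exp (I * (((y - x) / ε : ℝ) : ℂ) ^ 2)) * modBessel ν (2 * x * y / ε ^ 2 : ℝ)) := by
  have : (ε : ℂ) ≠ 0 := ofReal_ne_zero.2 hε.ne'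
  have hprefactor : prefactor ν (ε ^ 2 / 4) = 2 * (ε : ℂ)⁻¹ * prefactor ν 1 := by
    have hsqrt : √(2 * (ε ^ 2 / 4)) = √2 * (ε / 2) := by
      rw [Real.sqrt_mul zero_le_two, show ε ^ 2 / 4 = (ε / 2) ^ 2 by ring,
        Real.sqrt_sq (by positivity)]
    rw [prefactor, prefactor, hsqrt, mul_one]
    push_cast
    simp only [mul_inv, div_eq_mul_inv]
    ring
  have hphase : gaussianPhase (ε ^ 2 / 4) x y = exp (I * (((y - x) / ε : ℝ) : ℂ) ^ 2) := by
    rw [gaussianPhase]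
    congr 1
    push_cast
    field_simp
  have harg : besselArg (ε ^ 2 / 4) x y = ((2 * x * y / ε ^ 2 : ℝ) : ℂ) := by
    rw [besselArg]
    push_cast
    field_simp
    ring
  have hpos : 0 < 2 * x * y / ε ^ 2 := by positivity
  rw [besselKernel_eq_kernelCont (by positivity), kernelCont, kernelFactor, hprefactor, hphase,
    harg, cutBessel_of_re_pos (by rwa [ofReal_re]), ofReal_inv]
  ring

lemma tendsto_integral_besselKernel_Ioc (hν : 1 / 2 ≤ ν) (hx : x ∈ Set.Ioo 0 b)
    (hφ : ContinuousOn φ (Set.Icc 0 b)) (hφ' : IntervalIntegrable φ' volume 0 b)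
    (hderiv : ∀ y ∈ Set.Ioo 0 b, HasDerivAt φ (φ' y) y) :
    Tendsto (fun t => ∫ y in (0 : ℝ)..b, besselKernel ν t x y * φ y) (𝓝[>] 0) (𝓝 (φ x)) := by
  have hε : Tendsto (fun t : ℝ => 2 * √t) (𝓝[>] 0) (𝓝[>] 0) := by
    refine tendsto_nhdsWithin_iff.2 ⟨?_, eventually_mem_nhdsWithin.mono fun t ht =>
      mul_pos two_pos (Real.sqrt_pos.2 ht)⟩
    exact ((by fun_prop : Continuous fun t : ℝ => 2 * √t).tendsto' 0 0 (by simp)).mono_left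
      nhdsWithin_le_nhds
  have hlim := ((tendsto_integral_fresnelKernel_mul_modBessel hν hx hφ hφ' hderiv).const_mul
    (2 * prefactor ν 1)).comp hε
  rw [show 2 * prefactor ν 1 * (modBesselLimit ν * (2 * fresnelLimit * φ x)) = φ x by
    linear_combination φ x * two_mul_prefactor_one_mul_limits ν] at hlim
  refine hlim.congr' (eventually_mem_nhdsWithin.mono fun t (ht : 0 < t) => ?_)
  have hpos : 0 < 2 * √t := mul_pos two_pos (Real.sqrt_pos.2 ht)
  have ht_eq : (2 * √t) ^ 2 / 4 = t := by
    rw [mul_pow, Real.sq_sqrt ht.le]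
    ring
  rw [Function.comp_apply, ← intervalIntegral.integral_const_mul]
  refine intervalIntegral.integral_congr_ae (.of_forall fun y hy => ?_)
  rw [Set.uIoc_of_le (hx.1.le.trans hx.2.le)] at hy
  have hkernel := besselKernel_sq_div_four hpos hx.1 hy.1 ν
  rw [ht_eq] at hkernel
  rw [hkernel]
  ring

lemma tendsto_integral_besselKernel_of_pos (hν : 1 / 2 ≤ ν) (hx : 0 < x) (hxb : x < b)
    (hφ : ContDiffOn ℝ 1 φ (Set.Icc (-b) b)) :
    Tendsto (fun t => ∫ y in (-b)..b, besselKernel ν t x y * φ y) (𝓝[>] 0) (𝓝 (φ x)) := by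
  have hb : 0 < b := hx.trans hxb
  have hsub : Set.Icc 0 b ⊆ Set.Icc (-b) b := Set.Icc_subset_Icc_left (by linarith)
  have hφ' : ContinuousOn (derivWithin φ (Set.Icc (-b) b)) (Set.uIcc 0 b) := by
    rw [Set.uIcc_of_le hb.le]
    exact (hφ.continuousOn_derivWithin (uniqueDiffOn_Icc (by linarith)) le_rfl).mono hsub
  have hderiv : ∀ y ∈ Set.Ioo 0 b, HasDerivAt φ (derivWithin φ (Set.Icc (-b) b) y) y :=
    fun y hy => ((hφ.differentiableOn one_ne_zero) y
      (hsub (Set.Ioo_subset_Icc_self hy))).hasDerivWithinAt.hasDerivAt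
      (Icc_mem_nhds (by linarith [hy.1]) hy.2)
  refine (tendsto_integral_besselKernel_Ioc hν ⟨hx, hxb⟩ (hφ.continuousOn.mono hsub)
    hφ'.intervalIntegrable hderiv).congr fun t => ?_
  rw [intervalIntegral.integral_of_le hb.le, intervalIntegral.integral_of_le (by linarith)]
  refine (setIntegral_eq_of_subset_of_forall_sdiff_eq_zero measurableSet_Ioc
    (Set.Ioc_subset_Ioc_left (by linarith)) fun y hy => ?_).symm
  have hy0 : y ≤ 0 := not_lt.1 fun hpos => hy.2 ⟨hpos, hy.1.2⟩
  rw [besselKernel_of_nonpos (mul_nonpos_of_nonneg_of_nonpos hx.le hy0), zero_mul]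

lemma besselKernel_neg_right (ν t x y : ℝ) :
    besselKernel ν t x (-y) = besselKernel ν t (-x) y := by
  simp [besselKernel]

lemma tendsto_integral_besselKernel (hν : 1 / 2 ≤ ν) (hx : x ≠ 0) (hxb : |x| < b)
    (hφ : ContDiffOn ℝ 1 φ (Set.Icc (-b) b)) :
    Tendsto (fun t => ∫ y in (-b)..b, besselKernel ν t x y * φ y) (𝓝[>] 0) (𝓝 (φ x)) := by
  rcases hx.lt_or_gt with hneg | hpos
  · have hφ_neg : ContDiffOn ℝ 1 (fun y => φ (-y)) (Set.Icc (-b) b) :=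
      hφ.comp contDiff_neg.contDiffOn fun y hy => ⟨neg_le_neg hy.2, neg_le.1 hy.1⟩
    have hlim := tendsto_integral_besselKernel_of_pos hν (neg_pos.2 hneg)
      (by rwa [abs_of_neg hneg] at hxb) hφ_neg
    rw [neg_neg] at hlim
    refine hlim.congr fun t => ?_
    simpa [besselKernel_neg_right] using intervalIntegral.integral_comp_neg (a := -b) (b := b)
      fun y => besselKernel ν t x y * φ y
  · exact tendsto_integral_besselKernel_of_pos hν hpos (by rwa [abs_of_pos hpos] at hxb) hφ

end InitialCondition

end SchrodingerGreen

end

theorem proposition5p2 (lam : ℝ) (hlam : 0 < lam) (T : EReal) (hT : 0 < T) :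
    SchrodingerGreen.GreenAssumption T (fun _ x => ((lam / x ^ 2 : ℝ) : ℂ)) 1 0
      (SchrodingerGreen.besselKernel (√(1 / 4 + lam))) := by
  open SchrodingerGreen in
  set ν : ℝ := √(1 / 4 + lam) with hνdef
  have hν : 1 / 2 < ν := by
    rw [hνdef, Real.lt_sqrt (by norm_num)]
    norm_num [hlam]
  have hlamν : lam = ν ^ 2 - 1 / 4 := by
    rw [hνdef, Real.sq_sqrt (by positivity)]
    ring
  have hα : Real.pi / 4 < Real.pi / 2 := by linarith [Real.pi_pos]
  obtain ⟨C, hC⟩ := exists_norm_modBessel_le hν.le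
  refine ⟨Real.pi / 4, ⟨by positivity, hα⟩, kernelCont ν, ?_⟩
  exact
    { extends_G := fun t ht x _ y _ => (besselKernel_eq_kernelCont ht.1 ν x y).symm
      continuousOn := fun t ht x hx z hz => (differentiableAt_kernelCont hν.le ht.1 hx
        (re_ne_zero_of_mem_doubleSector hα hz)).continuousAt.continuousWithinAt
      holomorphic := fun t ht x hx z hz => (differentiableAt_kernelCont hν.le ht.1 hx
        (re_ne_zero_of_mem_doubleSector hα (interior_subset hz))).differentiableWithinAt
      ac12 := fun z hz => ac12_kernelCont hν.le T (re_ne_zero_of_mem_doubleSector hα hz)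
      schrodinger := fun z hz => hlamν ▸
        solvesSchrodinger_kernelCont hν.le T (re_ne_zero_of_mem_doubleSector hα hz)
      transmission := fun y hy t ht => transmissionCondition_besselKernel hν ht.1 hy
      initial := fun x hx => ⟨|x| + 1, lt_add_one _, fun φ hφ =>
        tendsto_integral_besselKernel hν.le hx (lt_add_one _) (hφ.of_le (by simp))⟩
      bounds := ⟨_, _, _, _, _, exponentialBounds_kernelCont hν.le T hα hC⟩ }
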